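/- For $v>0$ let $\zeta(s,v)$ denote the Hurwitz zeta function, i.e. the analytic continuation in $s$ to $\mathbb{C}\setminus\{1\}$ of $\sum_{n\ge 0}(n+v)^{-s}$ ($\operatorname{Re}s>1$), let $\zeta(s)=\zeta(s,1)$ be the Riemann zeta function, let $\zeta'(s,v)=\frac{\partial}{\partial s}\zeta(s,v)$, and let $G$ be the Barnes double gamma function, $$G(1+x)=(2\pi)^{x/2}\exp\left[-\tfrac12(\gamma x^2+x^2+x)\right]\prod_{k=1}^{\infty}\left\{\left(1+\frac{x}{k}\right)^k\exp\left(\frac{x^2}{2k}-x\right)\right\},$$ where $\gamma$ is Euler's constant. Then for every real $v>0$ the integral below converges absolutely and $$\int_0^\infty \frac{x^2\arctan(x/v)}{e^{2\pi x}-1}\,dx=\frac16 v^3\log v-\frac{11}{36}v^3+\frac12 v^2\log\Gamma(v)+\frac14 v^2\log(2\pi)+v\,\zeta'(-1)-\frac12\zeta'(-2,v)-v\log G(1+v).$$ In particular, for $v=1$, $$\int_0^\infty \frac{x^2\arctan x}{e^{2\pi x}-1}\,dx=-\frac{11}{36}+\frac14\log(2\pi)+\zeta'(-1)+\frac{\zeta(3)}{8\pi^2}.$$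 -/

import Mathlib

/-- The Hurwitz zeta function `ζ(s, v)` for real `v > 0`: the meromorphic continuation in `s` of
`∑_{n ≥ 0} (n + v)^{-s}`. Mathlib's `HurwitzZeta.hurwitzZeta` covers the parameters in `(0, 1]`
(taken modulo 1); writing `v = w + N` with `w ∈ (0, 1]` and `N ∈ ℕ`, the first `N` terms of the
series for `w` are removed. See `hasSum_hurwitzZetaPos` and `differentiableAt_hurwitzZetaPos`, which
characterise the function for `v > 0`. -/
noncomputable def hurwitzZetaPos (v : ℝ) (s : ℂ) : ℂ :=
  HurwitzZeta.hurwitzZeta ((v - ((⌈v⌉₊ - 1 : ℕ) : ℝ) : ℝ) : UnitAddCircle) s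
    - ∑ k ∈ Finset.range (⌈v⌉₊ - 1),
        1 / ((k : ℂ) + ((v - ((⌈v⌉₊ - 1 : ℕ) : ℝ) : ℝ) : ℂ)) ^ s

theorem hasSum_hurwitzZetaPos {v : ℝ} (hv : 0 < v) {s : ℂ} (hs : 1 < s.re) :
    HasSum (fun n : ℕ => 1 / ((n : ℂ) + (v : ℂ)) ^ s) (hurwitzZetaPos v s) := by
  unfold hurwitzZetaPos
  have hpos : 0 < ⌈v⌉₊ := Nat.ceil_pos.mpr hv
  have h1 : (((⌈v⌉₊ - 1 : ℕ) : ℝ)) = (⌈v⌉₊ : ℝ) - 1 := by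
    rw [Nat.cast_sub hpos]; simp
  have hlt : (⌈v⌉₊ : ℝ) < v + 1 := Nat.ceil_lt_add_one hv.le
  have hle : v ≤ (⌈v⌉₊ : ℝ) := Nat.le_ceil v
  generalize hN : ⌈v⌉₊ - 1 = N at *
  have hw : v - (N : ℝ) ∈ Set.Icc (0 : ℝ) 1 := by
    constructor <;> linarith
  have h := HurwitzZeta.hasSum_hurwitzZeta_of_one_lt_re hw hs
  rw [← hasSum_nat_add_iff' N] at h
  convert! h using 1
  ext n
  push_cast
  congr 2
  ring

theorem differentiableAt_hurwitzZetaPos {v : ℝ} (hv : 0 < v) {s : ℂ} (hs : s ≠ 1) :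
    DifferentiableAt ℂ (hurwitzZetaPos v) s := by
  unfold hurwitzZetaPos
  have hpos : 0 < ⌈v⌉₊ := Nat.ceil_pos.mpr hv
  have h1 : (((⌈v⌉₊ - 1 : ℕ) : ℝ)) = (⌈v⌉₊ : ℝ) - 1 := by
    rw [Nat.cast_sub hpos]; simp
  have hlt : (⌈v⌉₊ : ℝ) < v + 1 := Nat.ceil_lt_add_one hv.le
  generalize hN : ⌈v⌉₊ - 1 = N at *
  have hw : 0 < v - (N : ℝ) := by linarith
  generalize v - (N : ℝ) = w at *
  refine (HurwitzZeta.differentiableAt_hurwitzZeta _ hs).sub ?_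
  refine DifferentiableAt.fun_sum fun k _ => ?_
  have hk : (k : ℂ) + (w : ℂ) ≠ 0 := by
    have : (0 : ℝ) < (k : ℝ) + w := by positivity
    exact_mod_cast this.ne'
  have hk' : ((k : ℂ) + (w : ℂ)) ^ s ≠ 0 := by
    simp [Complex.cpow_eq_zero_iff, hk]
  exact (differentiableAt_const _).div
    ((differentiableAt_id).const_cpow (Or.inl hk)) hk'

/-- The Barnes `G`-function on the real line, through its Weierstrass canonical product
`G(1 + x) = (2π)^{x/2} exp(-(γx² + x² + x)/2) ∏_{k ≥ 1} (1 + x/k)^k exp(x²/(2k) - x)`,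
taken at `x = z - 1`. -/
noncomputable def barnesG (z : ℝ) : ℝ :=
  (2 * Real.pi) ^ ((z - 1) / 2)
    * Real.exp (-(Real.eulerMascheroniConstant * (z - 1) ^ 2 + (z - 1) ^ 2 + (z - 1)) / 2)
    * ∏' k : ℕ, (1 + (z - 1) / ((k : ℝ) + 1)) ^ (k + 1)
        * Real.exp ((z - 1) ^ 2 / (2 * ((k : ℝ) + 1)) - (z - 1))

theorem summable_log_barnesG {z : ℝ} (hz : 0 < z) :
    (∀ k : ℕ, 0 < (1 + (z - 1) / ((k : ℝ) + 1)) ^ (k + 1)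
        * Real.exp ((z - 1) ^ 2 / (2 * ((k : ℝ) + 1)) - (z - 1))) ∧
    Summable fun k : ℕ => Real.log ((1 + (z - 1) / ((k : ℝ) + 1)) ^ (k + 1)
        * Real.exp ((z - 1) ^ 2 / (2 * ((k : ℝ) + 1)) - (z - 1))) := by
  obtain ⟨x, rfl⟩ : ∃ x, z = x + 1 := ⟨z - 1, by ring⟩
  simp only [add_sub_cancel_right]
  have hb : ∀ k : ℕ, 0 < 1 + x / ((k : ℝ) + 1) := by
    intro k
    have hk : (0 : ℝ) < (k : ℝ) + 1 := by positivity
    have hk0 : (0 : ℝ) ≤ (k : ℝ) := by positivity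
    rw [show 1 + x / ((k : ℝ) + 1) = ((k : ℝ) + 1 + x) / ((k : ℝ) + 1) by field_simp]
    exact div_pos (by linarith) hk
  refine ⟨fun k => mul_pos (pow_pos (hb k) _) (Real.exp_pos _), ?_⟩
  have hs : Summable fun k : ℕ => 2 * |x| ^ 3 * (1 / ((k : ℝ) + 1) ^ 2) := by
    refine Summable.mul_left _ ?_
    exact_mod_cast (summable_nat_add_iff 1).mpr (Real.summable_one_div_nat_pow.mpr one_lt_two)
  refine Summable.of_norm_bounded_eventually_nat hs ?_
  filter_upwards [Filter.eventually_ge_atTop ⌈2 * |x|⌉₊] with k hkx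
  have hk : (0 : ℝ) < (k : ℝ) + 1 := by positivity
  have hkx' : 2 * |x| ≤ (k : ℝ) := Nat.ceil_le.mp hkx
  have hy : |(-(x / ((k : ℝ) + 1)))| ≤ 1 / 2 := by
    rw [abs_neg, abs_div, abs_of_pos hk, div_le_div_iff₀ hk two_pos]
    linarith
  have h := Real.abs_log_sub_add_sum_range_le (lt_of_le_of_lt hy (by norm_num)) 2
  rw [Real.log_mul (pow_pos (hb k) _).ne' (Real.exp_pos _).ne', Real.log_pow, Real.log_exp,
    Real.norm_eq_abs]
  have e : ((k + 1 : ℕ) : ℝ) * Real.log (1 + x / ((k : ℝ) + 1))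
        + (x ^ 2 / (2 * ((k : ℝ) + 1)) - x)
      = ((k : ℝ) + 1) * ((∑ i ∈ Finset.range 2, (-(x / ((k : ℝ) + 1))) ^ (i + 1) / ((i : ℝ) + 1))
        + Real.log (1 - (-(x / ((k : ℝ) + 1))))) := by
    simp only [Finset.sum_range_succ, Finset.sum_range_zero, sub_neg_eq_add]
    push_cast
    field_simp
    ring
  rw [e, abs_mul, abs_of_pos hk]
  have h2 : |(-(x / ((k : ℝ) + 1)))| ^ (2 + 1) / (1 - |(-(x / ((k : ℝ) + 1)))|)
      ≤ 2 * (|x| ^ 3 / ((k : ℝ) + 1) ^ 3) := by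
    rw [div_le_iff₀ (by linarith)]
    have : |(-(x / ((k : ℝ) + 1)))| ^ (2 + 1) = |x| ^ 3 / ((k : ℝ) + 1) ^ 3 := by
      rw [abs_neg, abs_div, abs_of_pos hk, div_pow]
    rw [this]
    have hp : 0 ≤ |x| ^ 3 / ((k : ℝ) + 1) ^ 3 := by positivity
    nlinarith
  calc ((k : ℝ) + 1) * _ ≤ ((k : ℝ) + 1) * (2 * (|x| ^ 3 / ((k : ℝ) + 1) ^ 3)) :=
        mul_le_mul_of_nonneg_left (h.trans h2) hk.le
    _ = 2 * |x| ^ 3 * (1 / ((k : ℝ) + 1) ^ 2) := by field_simp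

/-- The canonical product converges for `z > 0`. -/
theorem multipliable_barnesG {z : ℝ} (hz : 0 < z) :
    Multipliable fun k : ℕ => (1 + (z - 1) / ((k : ℝ) + 1)) ^ (k + 1)
        * Real.exp ((z - 1) ^ 2 / (2 * ((k : ℝ) + 1)) - (z - 1)) :=
  Real.multipliable_of_summable_log (summable_log_barnesG hz).1 (summable_log_barnesG hz).2

/-- `G` is positive on `(0, ∞)`, so that `Real.log (barnesG z)` is the real logarithm there. -/
theorem barnesG_pos {z : ℝ} (hz : 0 < z) : 0 < barnesG z := by
  unfold barnesG
  rw [← Real.rexp_tsum_eq_tprod (summable_log_barnesG hz).1 (summable_log_barnesG hz).2]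
  positivity

/-! The bridge is a Laplace transform in an auxiliary variable t. Let L_n(f) be the integral of f(t)
e^{-vt} t^{-n-1} over t > 0. If f = O(t³), the Mellin transform of f(t) e^{-vt} is analytic for Re s
> -3; if it equals Γ(s) B(s), the simple zeros of 1/Γ give B'(-n) = (-1)^n n! L_n(f) for n = 0, 1, 2
(`hasDerivAt_of_eq_mellin_div_Gamma`).

This principle is used twice. For f(t) = sin(xt) - xt, B is built from powers of v ± ix and v, and
L_2 + v L_1 + (v²/2) L_0 collapses to -x² arctan(x/v)/2 (`laplaceMoment_sin`). For f = `boseKernel`,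
that is 1/(1 - e^{-t}) - 1/t - 1/2 - ct, B is ζ(s, v) minus its leading terms in v, so L_n gives
ζ'(-n, v) up to elementary terms (`deriv_hurwitzZetaPos_neg_nat`). The second f is the integral of
the first against 2/(e^{2πx} - 1) dx (`boseKernel_eq_integral`), so Fubini turns the arctangent
integral into a combination of ζ'(0, v), ζ'(-1, v) and ζ'(-2, v). The constant c (which is 1/12)
cancels and is never evaluated.

It remains to identify ζ'(0, v) with log Γ and ζ'(-1, v) with log G. The difference equation in v
and the decay of L_n as v → ∞ express ζ'(-n, v) as a limit of finite sums, which is compared with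
the Gauss limit for Γ and the partial products for G. For v = 1, the functional equation supplies
ζ'(-2). -/

/-! ### Mellin transforms at nonpositive integers -/

/-- The derivative of `1 / Γ` at a nonpositive integer. -/
theorem Complex.hasDerivAt_inv_Gamma_neg_nat (n : ℕ) :
    HasDerivAt (fun s : ℂ => (Complex.Gamma s)⁻¹) ((-1) ^ n * (n.factorial : ℂ)) (-(n : ℂ)) := by
  -- Differentiating 1/Γ(s) = s · 1/Γ(s+1) carries the derivative from a + 1 down to a.
  have hstep : ∀ (a d : ℂ), HasDerivAt (fun s : ℂ => (Complex.Gamma s)⁻¹) d (a + 1) →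
      HasDerivAt (fun s : ℂ => (Complex.Gamma s)⁻¹) ((Complex.Gamma (a + 1))⁻¹ + a * d) a := by
    intro a d h
    have h1 : HasDerivAt (fun s : ℂ => (Complex.Gamma (s + 1))⁻¹) d a :=
      HasDerivAt.comp_add_const a 1 h
    have h2 := (hasDerivAt_id a).mul h1
    have e : (fun s : ℂ => (Complex.Gamma s)⁻¹)
        = (id : ℂ → ℂ) * fun s : ℂ => (Complex.Gamma (s + 1))⁻¹ := by
      ext s
      exact Complex.one_div_Gamma_eq_self_mul_one_div_Gamma_add_one s
    rw [e]
    simpa using h2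
  induction n with
  | zero =>
    have h := hstep 0 _ (Complex.differentiable_one_div_Gamma (0 + 1)).hasDerivAt
    simpa using h
  | succ n ih =>
    have h := hstep (-((n + 1 : ℕ) : ℂ)) ((-1) ^ n * (n.factorial : ℂ)) (by
      convert! ih using 1
      push_cast
      ring)
    convert! h using 1
    have : Complex.Gamma (-((n + 1 : ℕ) : ℂ) + 1) = 0 := by
      rw [Complex.Gamma_eq_zero_iff]
      exact ⟨n, by push_cast; ring⟩
    rw [this, Nat.factorial_succ]
    push_cast
    ring

/-- The cubic bound serves at both ends: the order t³ at 0 pushes the Mellin strip to Re s > -3,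
just enough for 0, -1, -2, and at infinity half of the exponential absorbs t³. -/
theorem isBigO_mul_exp_neg_of_abs_le_cube {f : ℝ → ℝ} {C v : ℝ} (hv : 0 < v)
    (hC : ∀ t, 0 < t → |f t| ≤ C * t ^ 3) :
    ((fun t : ℝ => ((f t * Real.exp (-v * t) : ℝ) : ℂ)) =O[Filter.atTop]
      fun t => Real.exp (-(v / 2) * t)) ∧
    ((fun t : ℝ => ((f t * Real.exp (-v * t) : ℝ) : ℂ)) =O[nhdsWithin 0 (Set.Ioi 0)]
      fun t => t ^ (-(-3 : ℝ))) := by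
  constructor
  · have h1 : f =O[Filter.atTop] fun t : ℝ => t ^ 3 := by
      refine Asymptotics.IsBigO.of_bound C ?_
      filter_upwards [Filter.eventually_gt_atTop 0] with t ht
      rw [Real.norm_eq_abs, Real.norm_eq_abs, abs_of_pos (pow_pos ht 3)]
      exact hC t ht
    have h2 := h1.trans (isLittleO_pow_exp_pos_mul_atTop 3 (half_pos hv)).isBigO
    have h3 := h2.mul (Asymptotics.isBigO_refl (fun t => Real.exp (-v * t)) Filter.atTop)
    refine Asymptotics.IsBigO.trans (Asymptotics.IsBigO.of_norm_left ?_) (h3.congr_right ?_)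
    · simp only [Complex.norm_real]
      exact (Asymptotics.isBigO_refl _ _).norm_left
    · intro t
      rw [← Real.exp_add]
      congr 1
      ring
  · refine Asymptotics.IsBigO.of_bound C ?_
    filter_upwards [self_mem_nhdsWithin] with t ht
    have ht : 0 < t := ht
    have e : t ^ (-(-3 : ℝ)) = t ^ 3 := by
      rw [neg_neg]
      exact_mod_cast Real.rpow_natCast t 3
    rw [Complex.norm_real, Real.norm_eq_abs, Real.norm_eq_abs, e, abs_of_pos (pow_pos ht 3), abs_mul,
      Real.abs_exp]
    have : Real.exp (-v * t) ≤ 1 := Real.exp_le_one_iff.mpr (by nlinarith)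
    calc |f t| * Real.exp (-v * t) ≤ |f t| * 1 := by gcongr
      _ ≤ C * t ^ 3 := by simpa using hC t ht

theorem locallyIntegrableOn_mul_exp_neg {f : ℝ → ℝ} (v : ℝ) (hf : ContinuousOn f (Set.Ioi 0)) :
    MeasureTheory.LocallyIntegrableOn (fun t : ℝ => ((f t * Real.exp (-v * t) : ℝ) : ℂ))
      (Set.Ioi 0) := by
  refine ContinuousOn.locallyIntegrableOn ?_ measurableSet_Ioi
  refine Complex.continuous_ofReal.comp_continuousOn (hf.mul ?_)
  fun_prop

theorem mellinConvergent_mul_exp_neg {f : ℝ → ℝ} {C v : ℝ} (hv : 0 < v)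
    (hf : ContinuousOn f (Set.Ioi 0)) (hC : ∀ t, 0 < t → |f t| ≤ C * t ^ 3) {s : ℂ}
    (hs : -3 < s.re) :
    MellinConvergent (fun t : ℝ => ((f t * Real.exp (-v * t) : ℝ) : ℂ)) s :=
  mellinConvergent_of_isBigO_rpow_exp (half_pos hv) (locallyIntegrableOn_mul_exp_neg v hf)
    (isBigO_mul_exp_neg_of_abs_le_cube hv hC).1 (isBigO_mul_exp_neg_of_abs_le_cube hv hC).2 hs

theorem differentiableAt_mellin_mul_exp_neg {f : ℝ → ℝ} {C v : ℝ} (hv : 0 < v)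
    (hf : ContinuousOn f (Set.Ioi 0)) (hC : ∀ t, 0 < t → |f t| ≤ C * t ^ 3) {s : ℂ}
    (hs : -3 < s.re) :
    DifferentiableAt ℂ (mellin (fun t : ℝ => ((f t * Real.exp (-v * t) : ℝ) : ℂ))) s :=
  mellin_differentiableAt_of_isBigO_rpow_exp (half_pos hv) (locallyIntegrableOn_mul_exp_neg v hf)
    (isBigO_mul_exp_neg_of_abs_le_cube hv hC).1 (isBigO_mul_exp_neg_of_abs_le_cube hv hC).2 hs

/-- The Laplace transform of `f t / t ^ (n + 1)` at `v`. -/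
noncomputable def laplaceMoment (f : ℝ → ℝ) (v : ℝ) (n : ℕ) : ℝ :=
  ∫ t in Set.Ioi (0 : ℝ), f t * Real.exp (-v * t) / t ^ (n + 1)

theorem cpow_neg_nat_sub_one {t : ℝ} (n : ℕ) :
    (t : ℂ) ^ (-(n : ℂ) - 1) = (((t ^ (n + 1))⁻¹ : ℝ) : ℂ) := by
  rw [show (-(n : ℂ) - 1) = -((n + 1 : ℕ) : ℂ) by push_cast; ring, Complex.cpow_neg,
    Complex.cpow_natCast]
  push_cast
  rfl

theorem mellin_mul_exp_neg_neg_nat (f : ℝ → ℝ) (v : ℝ) (n : ℕ) :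
    mellin (fun t : ℝ => ((f t * Real.exp (-v * t) : ℝ) : ℂ)) (-(n : ℂ))
      = (laplaceMoment f v n : ℂ) := by
  unfold mellin laplaceMoment
  rw [← integral_complex_ofReal]
  refine MeasureTheory.integral_congr_ae (Filter.Eventually.of_forall fun t => ?_)
  simp only [smul_eq_mul, cpow_neg_nat_sub_one]
  push_cast
  ring

theorem integrableOn_laplaceMoment {f : ℝ → ℝ} {C v : ℝ} (hv : 0 < v)
    (hf : ContinuousOn f (Set.Ioi 0)) (hC : ∀ t, 0 < t → |f t| ≤ C * t ^ 3) {n : ℕ} (hn : n < 3) :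
    MeasureTheory.IntegrableOn (fun t => f t * Real.exp (-v * t) / t ^ (n + 1)) (Set.Ioi 0) := by
  have h := mellinConvergent_mul_exp_neg hv hf hC (s := -(n : ℂ)) (by
    have : (n : ℝ) < 3 := by exact_mod_cast hn
    simpa using this)
  unfold MellinConvergent at h
  have h2 : MeasureTheory.IntegrableOn
      (fun t : ℝ => ((f t * Real.exp (-v * t) / t ^ (n + 1) : ℝ) : ℂ)) (Set.Ioi 0) := by
    refine h.congr (Filter.Eventually.of_forall fun t => ?_)
    simp only [smul_eq_mul, cpow_neg_nat_sub_one]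
    push_cast
    ring
  exact (MeasureTheory.Integrable.re h2).congr (Filter.Eventually.of_forall fun t => by
    simp only [RCLike.re_eq_complex_re, Complex.ofReal_re])

/-- A function that is analytic on the half plane `Re s > -3` outside `s = 1` and is given by a
Mellin transform over `Γ` for `Re s > 1` has as derivatives at `0, -1, -2` the Laplace moments. -/
theorem hasDerivAt_of_eq_mellin_div_Gamma {f : ℝ → ℝ} {C v : ℝ} (hv : 0 < v)
    (hf : ContinuousOn f (Set.Ioi 0)) (hC : ∀ t, 0 < t → |f t| ≤ C * t ^ 3) {B : ℂ → ℂ}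
    (hB : ∀ s, s ≠ 1 → DifferentiableAt ℂ B s)
    (heq : ∀ s : ℂ, 1 < s.re → Complex.Gamma s * B s
      = mellin (fun t : ℝ => ((f t * Real.exp (-v * t) : ℝ) : ℂ)) s) {n : ℕ} (hn : n < 3) :
    HasDerivAt B ((-1) ^ n * (n.factorial : ℂ) * (laplaceMoment f v n : ℂ)) (-(n : ℂ)) := by
  set M := mellin (fun t : ℝ => ((f t * Real.exp (-v * t) : ℝ) : ℂ)) with hM
  have hMd : ∀ s : ℂ, -3 < s.re → DifferentiableAt ℂ M s := fun s hs =>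
    differentiableAt_mellin_mul_exp_neg hv hf hC hs
  -- U ∪ V is a connected region that avoids the pole s = 1, contains 0, -1, -2 and reaches Re s >
  -- 1: the upper part U passes over the pole, and the strip V to its left meets the real axis. The
  -- continuation starts at 2 + i.
  set U : Set ℂ := {s : ℂ | -3 < s.re} ∩ {s : ℂ | 0 < s.im} with hU
  set V : Set ℂ := {s : ℂ | -3 < s.re} ∩ {s : ℂ | s.re < 1} with hV
  have hUo : IsOpen U := (isOpen_lt continuous_const Complex.continuous_re).inter
    (isOpen_lt continuous_const Complex.continuous_im)
  have hVo : IsOpen V := (isOpen_lt continuous_const Complex.continuous_re).inter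
    (isOpen_lt Complex.continuous_re continuous_const)
  have hUc : IsPreconnected U :=
    ((convex_halfSpace_re_gt _).inter (convex_halfSpace_im_gt _)).isPreconnected
  have hVc : IsPreconnected V :=
    ((convex_halfSpace_re_gt _).inter (convex_halfSpace_re_lt _)).isPreconnected
  have hW : IsPreconnected (U ∪ V) :=
    hUc.union Complex.I (by simp [hU]) (by simp [hV]) hVc
  have hWo : IsOpen (U ∪ V) := hUo.union hVo
  have hre : ∀ s ∈ U ∪ V, -3 < s.re := by
    rintro s (h | h)
    · exact h.1
    · exact h.1
  have hne : ∀ s ∈ U ∪ V, s ≠ 1 := by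
    rintro s (h | h) rfl
    · simp [hU] at h
    · simp [hV] at h
  have hBa : AnalyticOnNhd ℂ B (U ∪ V) :=
    DifferentiableOn.analyticOnNhd (fun s hs => (hB s (hne s hs)).differentiableWithinAt) hWo
  have hMa : AnalyticOnNhd ℂ (fun s => M s * (Complex.Gamma s)⁻¹) (U ∪ V) :=
    DifferentiableOn.analyticOnNhd (fun s hs =>
      ((hMd s (hre s hs)).mul (Complex.differentiable_one_div_Gamma s)).differentiableWithinAt) hWo
  have hEq := hBa.eqOn_of_preconnected_of_eventuallyEq hMa hW (z₀ := 2 + Complex.I)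
    (Or.inl (by simp [hU]; norm_num)) (by
      have : {s : ℂ | 1 < s.re} ∈ nhds (2 + Complex.I) :=
        (isOpen_lt continuous_const Complex.continuous_re).mem_nhds (by simp)
      filter_upwards [this] with s hs
      have hs' : (1 : ℝ) < s.re := hs
      rw [← heq s hs, mul_right_comm, mul_inv_cancel₀, one_mul]
      exact Complex.Gamma_ne_zero_of_re_pos (by linarith))
  have hn' : (n : ℝ) < 3 := by exact_mod_cast hn
  have hmem : -(n : ℂ) ∈ V := by
    constructor
    · simpa using hn'
    · have : (0 : ℝ) ≤ n := n.cast_nonneg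
      simp only [Set.mem_ofPred_eq, Complex.neg_re, Complex.natCast_re]
      linarith
  -- Since 1/Γ vanishes at -n, the term with the derivative of M drops out of the product rule.
  have h1 := (hMd (-(n : ℂ)) hmem.1).hasDerivAt.mul (Complex.hasDerivAt_inv_Gamma_neg_nat n)
  have h2 : HasDerivAt B _ (-(n : ℂ)) := h1.congr_of_eventuallyEq (by
    filter_upwards [hVo.mem_nhds hmem] with s hs
    exact hEq (Or.inr hs))
  have hG : Complex.Gamma (-(n : ℂ)) = 0 := by
    rw [Complex.Gamma_eq_zero_iff]
    exact ⟨n, rfl⟩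
  convert! h2 using 1
  rw [hG, hM, mellin_mul_exp_neg_neg_nat]
  ring

/-! ### Mellin transforms of complex exponentials -/

theorem norm_cpow_sub_one_mul_cexp (s z : ℂ) {t : ℝ} (ht : 0 < t) :
    ‖(t : ℂ) ^ (s - 1) * Complex.exp (-z * t)‖ = t ^ (s.re - 1) * Real.exp (-z.re * t) := by
  rw [norm_mul, Complex.norm_cpow_eq_rpow_re_of_pos ht, Complex.norm_exp]
  simp

theorem integrableOn_rpow_mul_exp_neg_mul {σ b : ℝ} (hσ : 0 < σ) (hb : 0 < b) :
    MeasureTheory.IntegrableOn (fun t : ℝ => t ^ (σ - 1) * Real.exp (-b * t)) (Set.Ioi 0) := by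
  have h := integrableOn_rpow_mul_exp_neg_mul_rpow (p := 1) (s := σ - 1) (b := b) (by linarith)
    one_pos hb
  simpa using h

theorem continuousOn_cpow_sub_one_mul_cexp (s z : ℂ) :
    ContinuousOn (fun t : ℝ => (t : ℂ) ^ (s - 1) * Complex.exp (-z * t)) (Set.Ioi 0) := by
  refine ContinuousOn.mul (fun t ht => ?_) (by fun_prop)
  exact (Complex.continuousAt_ofReal_cpow_const t (s - 1)
    (Or.inr (ne_of_gt ht))).continuousWithinAt

theorem integrableOn_cpow_sub_one_mul_cexp {s z : ℂ} (hs : 0 < s.re) (hz : 0 < z.re) :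
    MeasureTheory.IntegrableOn (fun t : ℝ => (t : ℂ) ^ (s - 1) * Complex.exp (-z * t))
      (Set.Ioi 0) := by
  refine (integrableOn_rpow_mul_exp_neg_mul hs hz).mono'
    ((continuousOn_cpow_sub_one_mul_cexp s z).aestronglyMeasurable measurableSet_Ioi) ?_
  refine (MeasureTheory.ae_restrict_iff' measurableSet_Ioi).mpr (Filter.Eventually.of_forall ?_)
  intro t ht
  exact (norm_cpow_sub_one_mul_cexp s z ht).le

theorem differentiableAt_integral_cpow_mul_cexp {s z : ℂ} (hs : 0 < s.re) (hz : 0 < z.re) :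
    DifferentiableAt ℂ
      (fun w : ℂ => ∫ t in Set.Ioi (0 : ℝ), (t : ℂ) ^ (s - 1) * Complex.exp (-w * t)) z := by
  have hs1 : 0 < (s + 1).re := by simp; linarith
  -- On this ball a single exponential with rate Re z / 2 dominates the z-derivative of the
  -- integrand.
  have hball : ∀ w ∈ Metric.ball z (z.re / 2), z.re / 2 < w.re := by
    intro w hw
    have h1 := Complex.abs_re_le_norm (w - z)
    rw [Metric.mem_ball, dist_eq_norm] at hw
    have h2 := abs_lt.mp (h1.trans_lt hw)
    simp only [Complex.sub_re] at h2
    linarith [h2.1]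
  have key := hasDerivAt_integral_of_dominated_loc_of_deriv_le
    (μ := MeasureTheory.volume.restrict (Set.Ioi (0 : ℝ)))
    (F := fun (w : ℂ) (t : ℝ) => (t : ℂ) ^ (s - 1) * Complex.exp (-w * t))
    (F' := fun (w : ℂ) (t : ℝ) => (t : ℂ) ^ (s - 1) * (Complex.exp (-w * t) * (-t)))
    (x₀ := z) (s := Metric.ball z (z.re / 2))
    (bound := fun t => t ^ (s.re + 1 - 1) * Real.exp (-(z.re / 2) * t))
    (Metric.ball_mem_nhds _ (half_pos hz))
    (Filter.Eventually.of_forall fun w =>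
      (continuousOn_cpow_sub_one_mul_cexp s w).aestronglyMeasurable measurableSet_Ioi)
    (integrableOn_cpow_sub_one_mul_cexp hs hz)
    (by
      have h := (continuousOn_cpow_sub_one_mul_cexp s z).mul
        (g := fun t : ℝ => (-t : ℂ)) (by fun_prop)
      refine (h.congr fun t _ => ?_).aestronglyMeasurable measurableSet_Ioi
      simp only [Pi.mul_apply, mul_assoc])
    (by
      refine (MeasureTheory.ae_restrict_iff' measurableSet_Ioi).mpr
        (Filter.Eventually.of_forall ?_)
      intro t ht w hw
      have ht : 0 < t := ht
      rw [← mul_assoc, norm_mul, norm_cpow_sub_one_mul_cexp s w ht, norm_neg, Complex.norm_real,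
        Real.norm_eq_abs, abs_of_pos ht, mul_right_comm, ← Real.rpow_add_one ht.ne',
        show s.re - 1 + 1 = s.re + 1 - 1 by ring]
      have := hball w hw
      gcongr)
    (integrableOn_rpow_mul_exp_neg_mul (by linarith) (half_pos hz))
    (by
      refine Filter.Eventually.of_forall ?_
      intro t w _
      have h1 : HasDerivAt (fun w : ℂ => -w * (t : ℂ)) (-t : ℂ) w := by
        simpa using ((hasDerivAt_id w).neg.mul_const (t : ℂ))
      exact h1.cexp.const_mul _)
  exact key.2.differentiableAt

/-- Both sides are analytic in z on the right half plane and agree for real z > 0. The identity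
theorem is applied at z = 1 along the points 1 + 1/(n+1). -/
theorem integral_cpow_mul_cexp_neg_mul {s z : ℂ} (hs : 0 < s.re) (hz : 0 < z.re) :
    ∫ t in Set.Ioi (0 : ℝ), (t : ℂ) ^ (s - 1) * Complex.exp (-z * t)
      = Complex.Gamma s * z ^ (-s) := by
  have hUo : IsOpen {w : ℂ | 0 < w.re} := isOpen_lt continuous_const Complex.continuous_re
  have hF : AnalyticOnNhd ℂ
      (fun w : ℂ => ∫ t in Set.Ioi (0 : ℝ), (t : ℂ) ^ (s - 1) * Complex.exp (-w * t))
      {w : ℂ | 0 < w.re} :=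
    DifferentiableOn.analyticOnNhd (fun w hw =>
      (differentiableAt_integral_cpow_mul_cexp hs hw).differentiableWithinAt) hUo
  have hG : AnalyticOnNhd ℂ (fun w : ℂ => Complex.Gamma s * w ^ (-s)) {w : ℂ | 0 < w.re} := by
    refine DifferentiableOn.analyticOnNhd (fun w hw => ?_) hUo
    exact (((differentiableAt_id).cpow_const (Or.inl hw)).const_mul _).differentiableWithinAt
  refine hF.eqOn_of_preconnected_of_frequently_eq hG
    (convex_halfSpace_re_gt 0).isPreconnected (z₀ := 1) (by simp) ?_ hz
  have ht : Filter.Tendsto (fun n : ℕ => ((1 + 1 / ((n : ℝ) + 1) : ℝ) : ℂ)) Filter.atTop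
      (nhdsWithin 1 {1}ᶜ) := by
    refine tendsto_nhdsWithin_iff.mpr ⟨?_, Filter.Eventually.of_forall fun n => ?_⟩
    · have h := (tendsto_const_nhds (x := (1 : ℝ))).add tendsto_one_div_add_atTop_nhds_zero_nat
      have h2 := (Complex.continuous_ofReal.tendsto _).comp h
      simpa [Function.comp_def] using h2
    · have : (0 : ℝ) < 1 / ((n : ℝ) + 1) := by positivity
      simp only [Set.mem_compl_iff, Set.mem_singleton_iff]
      intro h
      have h' : (1 + 1 / ((n : ℝ) + 1)) = 1 := by exact_mod_cast h
      linarith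
  refine ht.frequently (Filter.Frequently.of_forall fun n => ?_)
  have hr : (0 : ℝ) < 1 + 1 / ((n : ℝ) + 1) := by positivity
  generalize 1 + 1 / ((n : ℝ) + 1) = r at *
  have h := Complex.integral_cpow_mul_exp_neg_mul_Ioi hs hr
  simp only [neg_mul]
  rw [h, mul_comm, one_div, Complex.inv_cpow, Complex.cpow_neg]
  rw [Complex.arg_ofReal_of_nonneg hr.le]
  exact Real.pi_pos.ne

theorem hasMellin_cexp_neg_mul {s z : ℂ} (hs : 0 < s.re) (hz : 0 < z.re) :
    HasMellin (fun t : ℝ => Complex.exp (-z * t)) s (Complex.Gamma s * z ^ (-s)) :=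
  ⟨integrableOn_cpow_sub_one_mul_cexp hs hz, integral_cpow_mul_cexp_neg_mul hs hz⟩

theorem hasMellin_cpow_mul_cexp_neg_mul {s a z : ℂ} (hs : 0 < (s + a).re) (hz : 0 < z.re) :
    HasMellin (fun t : ℝ => (t : ℂ) ^ a * Complex.exp (-z * t)) s
      (Complex.Gamma (s + a) * z ^ (-(s + a))) := by
  have h := hasMellin_cexp_neg_mul hs hz
  refine ⟨?_, ?_⟩
  · have := MellinConvergent.cpow_smul (f := fun t : ℝ => Complex.exp (-z * t)) (s := s) (a := a)
    exact this.mpr h.1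
  · exact (mellin_cpow_smul (fun t : ℝ => Complex.exp (-z * t)) s a).trans h.2

theorem HasMellin.sub {f g : ℝ → ℂ} {s a b : ℂ} (hf : HasMellin f s a) (hg : HasMellin g s b) :
    HasMellin (fun t => f t - g t) s (a - b) := by
  have h := hasMellin_sub hf.1 hg.1
  rwa [hf.2, hg.2] at h

theorem HasMellin.const_mul {f : ℝ → ℂ} {s a : ℂ} (c : ℂ) (hf : HasMellin f s a) :
    HasMellin (fun t => c * f t) s (c * a) := by
  have h := hasMellin_const_smul hf.1 c
  simpa only [smul_eq_mul, hf.2] using h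

theorem HasMellin.congr {f g : ℝ → ℂ} {s a : ℂ} (hf : HasMellin f s a)
    (h : ∀ t, 0 < t → f t = g t) : HasMellin g s a := by
  have he : Set.EqOn (fun t : ℝ => (t : ℂ) ^ (s - 1) • f t) (fun t : ℝ => (t : ℂ) ^ (s - 1) • g t)
      (Set.Ioi 0) := fun t ht => by simp only [h t ht]
  refine ⟨hf.1.congr_fun he measurableSet_Ioi, ?_⟩
  rw [← hf.2]
  exact (MeasureTheory.setIntegral_congr_fun measurableSet_Ioi he).symm

/-! ### The sine kernel and the arctangent -/

theorem abs_sin_sub_self_le_cube {u : ℝ} (hu : 0 ≤ u) : |Real.sin u - u| ≤ u ^ 3 / 6 := by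
  have h1 := Real.sin_ge_sub_cube hu
  have h2 := Real.sin_le hu
  rw [abs_le]
  have : 0 ≤ u ^ 3 := by positivity
  constructor <;> linarith

theorem hasDerivAt_cpow_neg {z : ℂ} (hz : z ≠ 0) (s : ℂ) :
    HasDerivAt (fun s : ℂ => z ^ (-s)) (-Complex.log z * z ^ (-s)) s := by
  have h := (hasDerivAt_neg s).const_cpow (c := z) (Or.inl hz)
  convert! h using 1
  ring

theorem hasDerivAt_cpow_neg_neg_nat {z : ℂ} (hz : z ≠ 0) (n : ℕ) :
    HasDerivAt (fun s : ℂ => z ^ (-s)) (-Complex.log z * z ^ n) (-(n : ℂ)) := by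
  have h := hasDerivAt_cpow_neg hz (-(n : ℂ))
  rwa [neg_neg, Complex.cpow_natCast] at h

theorem hasDerivAt_mul_cpow_neg_sub_one {z : ℂ} (hz : z ≠ 0) (n : ℕ) :
    HasDerivAt (fun s : ℂ => s * z ^ (-s - 1)) (z ^ n / z * (1 + n * Complex.log z))
      (-(n : ℂ)) := by
  have e : (fun s : ℂ => s * z ^ (-s - 1)) = fun s => s * (z ^ (-s) / z) := by
    ext s
    rw [Complex.cpow_sub _ _ hz, Complex.cpow_one]
  rw [e]
  have h := (hasDerivAt_id (-(n : ℂ))).mul ((hasDerivAt_cpow_neg_neg_nat hz n).div_const z)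
  convert! h using 1
  rw [neg_neg, Complex.cpow_natCast]
  simp only [id]
  ring

/-- The function whose derivatives at `0, -1, -2` are the Laplace moments of `sin (x t) - x t`. -/
noncomputable def sinZetaFactor (v x : ℝ) (s : ℂ) : ℂ :=
  ((v - x * Complex.I : ℂ) ^ (-s) - (v + x * Complex.I : ℂ) ^ (-s)) / (2 * Complex.I)
    - x * (s * (v : ℂ) ^ (-s - 1))

/-- Euler's formula splits the sine into exponentials with rates v ∓ ix; the linear term contributes
Γ(s+1) v^{-s-1} = Γ(s) s v^{-s-1}. -/
theorem Gamma_mul_sinZetaFactor {v x : ℝ} (hv : 0 < v) {s : ℂ} (hs : 0 < s.re) :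
    Complex.Gamma s * sinZetaFactor v x s
      = mellin (fun t : ℝ => (((Real.sin (x * t) - x * t) * Real.exp (-v * t) : ℝ) : ℂ)) s := by
  have h1 := hasMellin_cexp_neg_mul (s := s) (z := v - x * Complex.I) hs (by simpa using hv)
  have h2 := hasMellin_cexp_neg_mul (s := s) (z := v + x * Complex.I) hs (by simpa using hv)
  have h3 := hasMellin_cpow_mul_cexp_neg_mul (s := s) (a := 1) (z := v)
    (by simp; linarith) (by simpa using hv)
  have h := ((h1.sub h2).const_mul (1 / (2 * Complex.I))).sub (h3.const_mul x)
  have h' := h.congr (g := fun t : ℝ =>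
      (((Real.sin (x * t) - x * t) * Real.exp (-v * t) : ℝ) : ℂ)) (by
    intro t ht
    push_cast
    rw [Complex.cpow_one,
      show -((v : ℂ) - x * Complex.I) * t = -v * t + (x * t) * Complex.I by ring,
      show -((v : ℂ) + x * Complex.I) * t = -v * t + -(x * t) * Complex.I by ring,
      Complex.exp_add, Complex.exp_add, Complex.exp_mul_I, Complex.exp_mul_I, Complex.cos_neg,
      Complex.sin_neg]
    field_simp [Complex.I_ne_zero]
    ring)
  rw [h'.2, sinZetaFactor, Complex.Gamma_add_one s (by rintro rfl; simp at hs),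
    show -(s + 1) = -s - 1 by ring]
  ring

theorem differentiable_sinZetaFactor {v : ℝ} (hv : 0 < v) (x : ℝ) :
    Differentiable ℂ (sinZetaFactor v x) := by
  intro s
  have hz1 : (v - x * Complex.I : ℂ) ≠ 0 := fun h => by
    have := congrArg Complex.re h
    simp at this
    exact hv.ne' this
  have hz2 : (v + x * Complex.I : ℂ) ≠ 0 := fun h => by
    have := congrArg Complex.re h
    simp at this
    exact hv.ne' this
  have hv' : (v : ℂ) ≠ 0 := by exact_mod_cast hv.ne'
  unfold sinZetaFactor
  refine ((((hasDerivAt_cpow_neg hz1 s).differentiableAt).sub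
    ((hasDerivAt_cpow_neg hz2 s).differentiableAt)).div_const _).sub ?_
  refine ((differentiableAt_id).mul ?_).const_mul _
  exact DifferentiableAt.const_cpow (by fun_prop) (Or.inl hv')

theorem continuousOn_sin_sub (x : ℝ) :
    ContinuousOn (fun t : ℝ => Real.sin (x * t) - x * t) (Set.Ioi 0) := by
  fun_prop

theorem abs_sin_mul_sub_le {x t : ℝ} (hx : 0 ≤ x) (ht : 0 < t) :
    |Real.sin (x * t) - x * t| ≤ x ^ 3 / 6 * t ^ 3 := by
  have := abs_sin_sub_self_le_cube (mul_nonneg hx ht.le)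
  rw [mul_pow] at this
  linarith

/-- After division by (-1)^n n!, the weights 1, v, v²/2 assemble z^n log z into ((z - v)²/2) log z.
At z = v ± ix the factor is -x²/2, so the moduli cancel in the difference of logarithms and the
arguments ± arctan(x/v) remain. The contributions of the linear term cancel. -/
theorem laplaceMoment_sin {v x : ℝ} (hv : 0 < v) (hx : 0 < x) :
    laplaceMoment (fun t => Real.sin (x * t) - x * t) v 2
      + v * laplaceMoment (fun t => Real.sin (x * t) - x * t) v 1
      + v ^ 2 / 2 * laplaceMoment (fun t => Real.sin (x * t) - x * t) v 0
      = -(x ^ 2 * Real.arctan (x / v)) / 2 := by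
  have hz1 : (v - x * Complex.I : ℂ) ≠ 0 := fun h => by
    have := congrArg Complex.re h
    simp at this
    exact hv.ne' this
  have hz2 : (v + x * Complex.I : ℂ) ≠ 0 := fun h => by
    have := congrArg Complex.re h
    simp at this
    exact hv.ne' this
  have hv' : (v : ℂ) ≠ 0 := by exact_mod_cast hv.ne'
  have key : ∀ n : ℕ, n < 3 →
      (-1) ^ n * (n.factorial : ℂ)
        * (laplaceMoment (fun t => Real.sin (x * t) - x * t) v n : ℂ)
      = (-Complex.log (v - x * Complex.I) * (v - x * Complex.I : ℂ) ^ n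
          - -Complex.log (v + x * Complex.I) * (v + x * Complex.I : ℂ) ^ n) / (2 * Complex.I)
        - x * ((v : ℂ) ^ n / v * (1 + n * Complex.log v)) := by
    intro n hn
    refine (hasDerivAt_of_eq_mellin_div_Gamma hv (continuousOn_sin_sub x)
      (fun t ht => abs_sin_mul_sub_le hx.le ht)
      (fun s _ => differentiable_sinZetaFactor hv x s)
      (fun s hs => Gamma_mul_sinZetaFactor hv (by linarith)) hn).unique ?_
    exact (((hasDerivAt_cpow_neg_neg_nat hz1 n).sub
      (hasDerivAt_cpow_neg_neg_nat hz2 n)).div_const _).sub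
      ((hasDerivAt_mul_cpow_neg_sub_one hv' n).const_mul _)
  have hlog2 : Complex.log (v + x * Complex.I)
      = Real.log ‖(v + x * Complex.I : ℂ)‖ + Real.arctan (x / v) * Complex.I := by
    have : Complex.arg (v + x * Complex.I) = Real.arctan (x / v) := by
      have hlt : |Complex.arg (v + x * Complex.I)| < Real.pi / 2 :=
        Complex.abs_arg_lt_pi_div_two_iff.mpr (Or.inl (by simpa using hv))
      have htan := Complex.tan_arg (v + x * Complex.I)
      rw [show (v + x * Complex.I : ℂ).im / (v + x * Complex.I : ℂ).re = x / v by simp] at htan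
      rw [← htan, Real.arctan_tan (abs_lt.mp hlt).1 (abs_lt.mp hlt).2]
    rw [Complex.log, this]
  have hconj : (v - x * Complex.I : ℂ) = (starRingEnd ℂ) (v + x * Complex.I) := by
    simp [sub_eq_add_neg]
  have hlog1 : Complex.log (v - x * Complex.I)
      = Real.log ‖(v + x * Complex.I : ℂ)‖ - Real.arctan (x / v) * Complex.I := by
    rw [hconj, Complex.log_conj, hlog2]
    · rw [map_add, map_mul, Complex.conj_ofReal, Complex.conj_ofReal, Complex.conj_I]
      ring
    · intro h
      rw [Complex.arg_eq_pi_iff] at h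
      simp at h
      linarith [h.1]
  have k0 := key 0 (by norm_num)
  have k1 := key 1 (by norm_num)
  have k2 := key 2 (by norm_num)
  rw [hlog1, hlog2] at k0 k1 k2
  generalize Real.log ‖(v + x * Complex.I : ℂ)‖ = R at *
  generalize Real.arctan (x / v) = θ at *
  have hfac : ((2 : ℕ).factorial : ℂ) = 2 := by norm_num [Nat.factorial]
  rw [Nat.factorial_zero, pow_zero, pow_zero, pow_zero, pow_zero] at k0
  rw [Nat.factorial_one, pow_one, pow_one, pow_one, pow_one, div_self hv'] at k1
  rw [hfac, show (v : ℂ) ^ 2 / v = v by field_simp] at k2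
  push_cast at k0 k1 k2
  have hJ : Complex.I * (2 * Complex.I)⁻¹ = 1 / 2 := by field_simp [Complex.I_ne_zero]
  have hV : (v : ℂ) * (1 / v) = 1 := by field_simp
  have : ((laplaceMoment (fun t => Real.sin (x * t) - x * t) v 2
      + v * laplaceMoment (fun t => Real.sin (x * t) - x * t) v 1
      + v ^ 2 / 2 * laplaceMoment (fun t => Real.sin (x * t) - x * t) v 0 : ℝ) : ℂ)
      = ((-(x ^ 2 * θ) / 2 : ℝ) : ℂ) := by
    push_cast
    simp only [div_eq_mul_inv _ (2 * Complex.I)] at k0 k1 k2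
    linear_combination (1 / 2 : ℂ) * k2 - v * k1 + (v : ℂ) ^ 2 / 2 * k0
      - x * v / 2 * hV - (x : ℂ) ^ 2 * θ * hJ
      + (x : ℂ) ^ 2 * θ * Complex.I * (2 * Complex.I)⁻¹ * Complex.I_sq
  exact_mod_cast this

/-! ### The weight 1/(e^{2πx} - 1) and its sine transform -/

/-- This is u/2 ≤ sinh(u/2). It bounds 1/(e^u - 1) by e^{-u/2}/u, controlling the singularity at 0
and the decay together. -/
theorem mul_exp_half_le_exp_sub_one {u : ℝ} (hu : 0 ≤ u) :
    u * Real.exp (u / 2) ≤ Real.exp u - 1 := by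
  have h := Real.self_le_sinh_iff.mpr (show 0 ≤ u / 2 by linarith)
  rw [Real.sinh_eq] at h
  have h2 : u ≤ Real.exp (u / 2) - Real.exp (-(u / 2)) := by linarith
  have h3 := mul_le_mul_of_nonneg_right h2 (Real.exp_pos (u / 2)).le
  rw [sub_mul, ← Real.exp_add, ← Real.exp_add] at h3
  simpa using h3

theorem exp_two_pi_mul_sub_one_pos {x : ℝ} (hx : 0 < x) :
    0 < Real.exp (2 * Real.pi * x) - 1 := by
  have : 0 < 2 * Real.pi * x := by positivity
  linarith [Real.add_one_lt_exp this.ne']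

theorem continuousOn_bose : ContinuousOn (fun x : ℝ => Real.exp (2 * Real.pi * x) - 1)
    (Set.Ioi 0) := by
  fun_prop

theorem integrableOn_pow_div_exp_sub_one (m : ℕ) :
    MeasureTheory.IntegrableOn (fun x : ℝ => x ^ (m + 1) / (Real.exp (2 * Real.pi * x) - 1))
      (Set.Ioi 0) := by
  have h := integrableOn_rpow_mul_exp_neg_mul (σ := (m : ℝ) + 1) (b := Real.pi)
    (by positivity) Real.pi_pos
  refine MeasureTheory.Integrable.mono' (h.const_mul (1 / (2 * Real.pi))) ?_ ?_
  · refine ContinuousOn.aestronglyMeasurable ?_ measurableSet_Ioi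
    exact ContinuousOn.div (by fun_prop) continuousOn_bose
      fun x hx => (exp_two_pi_mul_sub_one_pos hx).ne'
  · refine (MeasureTheory.ae_restrict_iff' measurableSet_Ioi).mpr
      (Filter.Eventually.of_forall ?_)
    intro x hx
    have hx : 0 < x := hx
    have hpos := exp_two_pi_mul_sub_one_pos hx
    rw [Real.norm_eq_abs, abs_of_pos (by positivity), add_sub_cancel_right, Real.rpow_natCast,
      div_le_iff₀ hpos]
    have h1 := mul_exp_half_le_exp_sub_one (u := 2 * Real.pi * x) (by positivity)
    rw [show 2 * Real.pi * x / 2 = Real.pi * x by ring] at h1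
    have h2 : Real.exp (-Real.pi * x) * Real.exp (Real.pi * x) = 1 := by
      rw [← Real.exp_add]; simp
    calc x ^ (m + 1) = 1 / (2 * Real.pi) * (x ^ m * Real.exp (-Real.pi * x))
          * (2 * Real.pi * x * Real.exp (Real.pi * x)) := by
          have : 1 / (2 * Real.pi) * (x ^ m * Real.exp (-Real.pi * x))
            * (2 * Real.pi * x * Real.exp (Real.pi * x))
            = x ^ (m + 1) * (Real.exp (-Real.pi * x) * Real.exp (Real.pi * x)) := by
            field_simp
            ring
          rw [this, h2, mul_one]
      _ ≤ _ := by gcongr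

theorem hasSum_inv_exp_sub_one {x : ℝ} (hx : 0 < x) :
    HasSum (fun n : ℕ => Real.exp (-(2 * Real.pi * (n + 1)) * x))
      (1 / (Real.exp (2 * Real.pi * x) - 1)) := by
  have hpos := exp_two_pi_mul_sub_one_pos hx
  have hr : Real.exp (-(2 * Real.pi * x)) < 1 :=
    Real.exp_lt_one_iff.mpr (neg_lt_zero.mpr (by positivity))
  have h := (hasSum_geometric_of_lt_one (Real.exp_pos _).le hr).mul_left
    (Real.exp (-(2 * Real.pi * x)))
  convert! h using 1
  · ext n
    rw [← Real.exp_nat_mul, ← Real.exp_add]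
    congr 1
    ring
  · rw [Real.exp_neg] at hr ⊢
    field_simp

theorem integrableOn_cexp_mul {a t : ℝ} (ha : 0 < a) :
    MeasureTheory.IntegrableOn (fun x : ℝ => Complex.exp (-(a - t * Complex.I) * x))
      (Set.Ioi 0) := by
  have h := integrableOn_cpow_sub_one_mul_cexp (s := 1) (z := a - t * Complex.I) (by simp)
    (by simpa using ha)
  simpa using h

theorem im_cexp_eq (a t x : ℝ) :
    (Complex.exp (-(a - t * Complex.I) * x)).im = Real.sin (x * t) * Real.exp (-a * x) := by
  rw [Complex.exp_im]
  simp
  rw [mul_comm, mul_comm t x]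

theorem integrableOn_sin_mul_exp {a : ℝ} (ha : 0 < a) (t : ℝ) :
    MeasureTheory.IntegrableOn (fun x : ℝ => Real.sin (x * t) * Real.exp (-a * x))
      (Set.Ioi 0) := by
  have h := (integrableOn_cexp_mul (t := t) ha).im
  refine h.congr (Filter.Eventually.of_forall fun x => ?_)
  exact im_cexp_eq a t x

theorem integral_sin_mul_exp {a : ℝ} (ha : 0 < a) (t : ℝ) :
    ∫ x in Set.Ioi (0 : ℝ), Real.sin (x * t) * Real.exp (-a * x) = t / (a ^ 2 + t ^ 2) := by
  have h := integral_im (integrableOn_cexp_mul (t := t) ha)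
  have h2 : ∫ x in Set.Ioi (0 : ℝ), Real.sin (x * t) * Real.exp (-a * x)
      = (∫ x in Set.Ioi (0 : ℝ), Complex.exp (-(a - t * Complex.I) * x)).im := by
    rw [show (∫ x in Set.Ioi (0 : ℝ), Complex.exp (-(a - t * Complex.I) * x)).im
      = _ from h.symm]
    exact MeasureTheory.integral_congr_ae (Filter.Eventually.of_forall fun x =>
      (im_cexp_eq a t x).symm)
  rw [h2, integral_exp_mul_complex_Ioi (by simpa using ha)]
  simp [Complex.div_im, Complex.normSq_apply]
  field_simp

theorem integral_mul_exp {a : ℝ} (ha : 0 < a) :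
    ∫ x in Set.Ioi (0 : ℝ), x * Real.exp (-a * x) = 1 / a ^ 2 := by
  have h := Real.integral_rpow_mul_exp_neg_mul_Ioi (a := 2) (r := a) two_pos ha
  rw [show (2 : ℝ) - 1 = 1 by norm_num, Real.Gamma_two, mul_one, Real.rpow_two, one_div_pow] at h
  rw [← h]
  simp only [Real.rpow_one, neg_mul]

theorem integrableOn_mul_exp {a : ℝ} (ha : 0 < a) :
    MeasureTheory.IntegrableOn (fun x : ℝ => x * Real.exp (-a * x)) (Set.Ioi 0) := by
  have h := integrableOn_rpow_mul_exp_neg_mul (σ := 2) two_pos ha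
  rw [show (2 : ℝ) - 1 = 1 by norm_num] at h
  simpa only [Real.rpow_one] using h

/-- The weight is expanded as a geometric series and integrated termwise; |sin(xt)| ≤ xt makes the
norms summable like 1/(n+1)². -/
theorem hasSum_integral_sin_div_exp_sub_one {t : ℝ} (ht : 0 < t) :
    HasSum (fun n : ℕ => t / ((2 * Real.pi * (n + 1)) ^ 2 + t ^ 2))
      (∫ x in Set.Ioi (0 : ℝ), Real.sin (x * t) / (Real.exp (2 * Real.pi * x) - 1)) := by
  have ha : ∀ n : ℕ, 0 < 2 * Real.pi * ((n : ℝ) + 1) := fun n => by positivity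
  have hint : ∀ n : ℕ, MeasureTheory.IntegrableOn
      (fun x : ℝ => Real.sin (x * t) * Real.exp (-(2 * Real.pi * (n + 1)) * x)) (Set.Ioi 0) :=
    fun n => integrableOn_sin_mul_exp (ha n) t
  have hsum : Summable fun n : ℕ => ∫ x in Set.Ioi (0 : ℝ),
      ‖Real.sin (x * t) * Real.exp (-(2 * Real.pi * (n + 1)) * x)‖ := by
    have hs : Summable fun n : ℕ => t / (2 * Real.pi) ^ 2 * (1 / ((n : ℝ) + 1) ^ 2) := by
      refine Summable.mul_left _ ?_
      exact_mod_cast (summable_nat_add_iff 1).mpr (Real.summable_one_div_nat_pow.mpr one_lt_two)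
    refine Summable.of_nonneg_of_le (fun n => MeasureTheory.integral_nonneg fun x => norm_nonneg _)
      (fun n => ?_) hs
    have h1 : t / (2 * Real.pi) ^ 2 * (1 / ((n : ℝ) + 1) ^ 2)
        = ∫ x in Set.Ioi (0 : ℝ), t * (x * Real.exp (-(2 * Real.pi * (n + 1)) * x)) := by
      rw [MeasureTheory.integral_const_mul, integral_mul_exp (ha n)]
      field_simp
    rw [h1]
    refine MeasureTheory.setIntegral_mono_on (hint n).norm
      ((integrableOn_mul_exp (ha n)).const_mul t) measurableSet_Ioi fun x hx => ?_
    have hx : 0 < x := hx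
    rw [norm_mul, Real.norm_eq_abs, Real.norm_eq_abs, Real.abs_exp, ← mul_assoc]
    gcongr
    have := Real.abs_sin_le_abs (x := x * t)
    rw [abs_of_pos (mul_pos hx ht)] at this
    linarith
  have h := MeasureTheory.hasSum_integral_of_summable_integral_norm hint hsum
  convert! h using 1
  · ext n
    exact (integral_sin_mul_exp (ha n) t).symm
  · refine MeasureTheory.setIntegral_congr_fun measurableSet_Ioi fun x hx => ?_
    have := ((hasSum_inv_exp_sub_one hx).mul_left (Real.sin (x * t))).tsum_eq
    rw [this]
    ring

/-- The series is the partial fraction expansion of π cot(πz) at z = it/(2π), where e^{2πiz} =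
e^{-t}. -/
theorem integral_sin_div_exp_sub_one {t : ℝ} (ht : 0 < t) :
    ∫ x in Set.Ioi (0 : ℝ), Real.sin (x * t) / (Real.exp (2 * Real.pi * x) - 1)
      = (1 / (1 - Real.exp (-t)) - 1 / t - 1 / 2) / 2 := by
  have hsum := (hasSum_integral_sin_div_exp_sub_one ht).tsum_eq
  rw [← hsum]
  have hπ : (Real.pi : ℂ) ≠ 0 := by exact_mod_cast Real.pi_pos.ne'
  have ht' : (t : ℂ) ≠ 0 := by exact_mod_cast ht.ne'
  have him : 0 < ((t / (2 * Real.pi) : ℝ) * Complex.I : ℂ).im := by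
    simp only [Complex.mul_I_im, Complex.ofReal_re]
    positivity
  set z : UpperHalfPlane := ⟨(t / (2 * Real.pi) : ℝ) * Complex.I, him⟩ with hz
  have hzc : (z : ℂ) = (t / (2 * Real.pi) : ℝ) * Complex.I := rfl
  have h1 := pi_mul_cot_pi_q_exp z
  have h2 := cot_series_rep (UpperHalfPlane.coe_mem_integerComplement z)
  have hq : Complex.exp (2 * Real.pi * Complex.I * z) = ((Real.exp (-t) : ℝ) : ℂ) := by
    rw [hzc]
    push_cast
    congr 1
    field_simp
    rw [Complex.I_sq]
  have hr : Real.exp (-t) < 1 := Real.exp_lt_one_iff.mpr (neg_lt_zero.mpr ht)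
  rw [h1, hq, tsum_geometric_of_norm_lt_one (by
    rw [Complex.norm_real, Real.norm_eq_abs, Real.abs_exp]; exact hr),
    tsum_pnat_eq_tsum_succ (f := fun n : ℕ => 1 / ((z : ℂ) - n) + 1 / ((z : ℂ) + n))] at h2
  have hterm : ∀ n : ℕ, 1 / ((z : ℂ) - (n + 1 : ℕ)) + 1 / ((z : ℂ) + (n + 1 : ℕ))
      = -4 * Real.pi * Complex.I * ((t / ((2 * Real.pi * (n + 1)) ^ 2 + t ^ 2) : ℝ) : ℂ) := by
    intro n
    have e1 : (z : ℂ) - (n + 1 : ℕ) ≠ 0 := fun h => by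
      have := congrArg Complex.im h
      rw [Complex.sub_im, Complex.natCast_im, Complex.zero_im, hzc] at this
      linarith
    have e2 : (z : ℂ) + (n + 1 : ℕ) ≠ 0 := fun h => by
      have := congrArg Complex.im h
      rw [Complex.add_im, Complex.natCast_im, Complex.zero_im, hzc] at this
      linarith
    have e3 : ((2 * Real.pi * (n + 1)) ^ 2 + t ^ 2 : ℂ) ≠ 0 := by
      have : (0 : ℝ) < (2 * Real.pi * (n + 1)) ^ 2 + t ^ 2 := by positivity
      exact_mod_cast this.ne'
    rw [div_add_div _ _ e1 e2]
    push_cast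
    rw [div_eq_iff (mul_ne_zero (by exact_mod_cast e1) (by exact_mod_cast e2)), hzc]
    push_cast
    rw [mul_div_assoc', div_mul_eq_mul_div (-4 * (Real.pi : ℂ) * Complex.I * t), eq_div_iff e3]
    field_simp
    ring_nf
    simp only [show Complex.I ^ 3 = -Complex.I by rw [pow_succ, Complex.I_sq]; ring]
    ring
  rw [tsum_congr hterm, tsum_mul_left, ← Complex.ofReal_tsum, hzc] at h2
  generalize (∑' n : ℕ, t / ((2 * Real.pi * ((n : ℝ) + 1)) ^ 2 + t ^ 2)) = S at *
  have hne : (1 - ((Real.exp (-t) : ℝ) : ℂ)) ≠ 0 := by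
    have : (0 : ℝ) < 1 - Real.exp (-t) := by linarith
    exact_mod_cast this.ne'
  have : (S : ℂ) = (((1 / (1 - Real.exp (-t)) - 1 / t - 1 / 2) / 2 : ℝ) : ℂ) := by
    have hK : (4 * Real.pi * Complex.I : ℂ) ≠ 0 :=
      mul_ne_zero (mul_ne_zero (by norm_num) hπ) Complex.I_ne_zero
    apply mul_left_cancel₀ hK
    have h3 : 1 / (((t / (2 * Real.pi) : ℝ) : ℂ) * Complex.I)
        = -(2 * Real.pi * Complex.I) * (1 / t) := by
      push_cast
      field_simp
      rw [Complex.I_sq, neg_neg]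
    rw [h3] at h2
    simp only [Complex.ofReal_sub, Complex.ofReal_div, Complex.ofReal_one, Complex.ofReal_ofNat]
    rw [← one_div] at h2
    linear_combination h2
  exact_mod_cast this

/-! ### The kernel as an average of sine kernels, and Fubini -/

/-- Twice the first moment of the weight `1 / (exp (2 π x) - 1)`. -/
noncomputable def boseConst : ℝ :=
  2 * ∫ x in Set.Ioi (0 : ℝ), x / (Real.exp (2 * Real.pi * x) - 1)

/-- The generating function `1 / (1 - exp (-t))` with its expansion at `0` removed up to order two. -/
noncomputable def boseKernel (t : ℝ) : ℝ :=
  1 / (1 - Real.exp (-t)) - 1 / t - 1 / 2 - boseConst * t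

theorem one_sub_exp_neg_pos {t : ℝ} (ht : 0 < t) : 0 < 1 - Real.exp (-t) :=
  sub_pos.mpr (Real.exp_lt_one_iff.mpr (neg_lt_zero.mpr ht))

theorem continuousOn_boseKernel : ContinuousOn boseKernel (Set.Ioi 0) := by
  unfold boseKernel
  refine ((ContinuousOn.sub ?_ ?_).sub continuousOn_const).sub (by fun_prop)
  · exact continuousOn_const.div (by fun_prop) fun t ht => (one_sub_exp_neg_pos ht).ne'
  · exact continuousOn_const.div (by fun_prop) fun t ht => ne_of_gt ht

theorem integrableOn_self_div_exp_sub_one :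
    MeasureTheory.IntegrableOn (fun x : ℝ => x / (Real.exp (2 * Real.pi * x) - 1))
      (Set.Ioi 0) := by
  simpa using integrableOn_pow_div_exp_sub_one 0

theorem integrableOn_sin_div_exp_sub_one {t : ℝ} (ht : 0 < t) :
    MeasureTheory.IntegrableOn
      (fun x : ℝ => Real.sin (x * t) / (Real.exp (2 * Real.pi * x) - 1)) (Set.Ioi 0) := by
  refine MeasureTheory.Integrable.mono' (integrableOn_self_div_exp_sub_one.const_mul t) ?_ ?_
  · refine ContinuousOn.aestronglyMeasurable ?_ measurableSet_Ioi
    exact ContinuousOn.div (by fun_prop) continuousOn_bose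
      fun x hx => (exp_two_pi_mul_sub_one_pos hx).ne'
  · refine (MeasureTheory.ae_restrict_iff' measurableSet_Ioi).mpr
      (Filter.Eventually.of_forall ?_)
    intro x hx
    have hx : 0 < x := hx
    have hpos := exp_two_pi_mul_sub_one_pos hx
    have := Real.abs_sin_le_abs (x := x * t)
    rw [abs_of_pos (mul_pos hx ht)] at this
    rw [Real.norm_eq_abs, abs_div, abs_of_pos hpos, mul_div_assoc', mul_comm t x]
    gcongr

theorem boseKernel_eq_integral {t : ℝ} (ht : 0 < t) :
    boseKernel t = ∫ x in Set.Ioi (0 : ℝ),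
      2 / (Real.exp (2 * Real.pi * x) - 1) * (Real.sin (x * t) - x * t) := by
  have h := integral_sin_div_exp_sub_one ht
  have e : ∀ x : ℝ, 2 / (Real.exp (2 * Real.pi * x) - 1) * (Real.sin (x * t) - x * t)
      = 2 * (Real.sin (x * t) / (Real.exp (2 * Real.pi * x) - 1))
        - 2 * t * (x / (Real.exp (2 * Real.pi * x) - 1)) := fun x => by ring
  simp only [e]
  rw [MeasureTheory.integral_sub ((integrableOn_sin_div_exp_sub_one ht).const_mul 2)
    (integrableOn_self_div_exp_sub_one.const_mul (2 * t)), MeasureTheory.integral_const_mul,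
    MeasureTheory.integral_const_mul, h, boseKernel, boseConst]
  ring

/-- Integrating |sin u - u| ≤ u³/6 against the weight yields the cubic bound for all t > 0, without
any Taylor expansion of the kernel. -/
theorem abs_boseKernel_le {t : ℝ} (ht : 0 < t) :
    |boseKernel t|
      ≤ (1 / 3 * ∫ x in Set.Ioi (0 : ℝ), x ^ 3 / (Real.exp (2 * Real.pi * x) - 1)) * t ^ 3 := by
  rw [boseKernel_eq_integral ht, mul_right_comm, ← MeasureTheory.integral_const_mul,
    ← Real.norm_eq_abs]
  refine MeasureTheory.norm_integral_le_of_norm_le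
    ((integrableOn_pow_div_exp_sub_one 2).const_mul _) ?_
  refine (MeasureTheory.ae_restrict_iff' measurableSet_Ioi).mpr (Filter.Eventually.of_forall ?_)
  intro x hx
  have hx : 0 < x := hx
  have hpos := exp_two_pi_mul_sub_one_pos hx
  rw [Real.norm_eq_abs, abs_mul, abs_of_pos (by positivity)]
  calc 2 / (Real.exp (2 * Real.pi * x) - 1) * |Real.sin (x * t) - x * t|
      ≤ 2 / (Real.exp (2 * Real.pi * x) - 1) * (x ^ 3 / 6 * t ^ 3) := by
        gcongr
        exact abs_sin_mul_sub_le hx.le ht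
    _ = _ := by ring

/-- The same cubic bound gives a majorant that is a product of a function of x and a function of t.
-/
theorem integrable_boseKernel_prod {v : ℝ} (hv : 0 < v) {n : ℕ} (hn : n < 3) :
    MeasureTheory.Integrable (Function.uncurry fun x t : ℝ =>
      2 / (Real.exp (2 * Real.pi * x) - 1) *
        ((Real.sin (x * t) - x * t) * Real.exp (-v * t) / t ^ (n + 1)))
      ((MeasureTheory.volume.restrict (Set.Ioi 0)).prod
        (MeasureTheory.volume.restrict (Set.Ioi 0))) := by
  have h1 := integrableOn_laplaceMoment (f := fun t => t ^ 3) (C := 1) hv (by fun_prop)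
    (fun t ht => by rw [abs_of_pos (pow_pos ht 3), one_mul]) hn
  have h2 := MeasureTheory.Integrable.mul_prod
    ((integrableOn_pow_div_exp_sub_one 2).const_mul (1 / 3)) h1
  refine h2.mono' ?_ ?_
  · refine Measurable.aestronglyMeasurable ?_
    unfold Function.uncurry
    fun_prop
  · rw [MeasureTheory.Measure.prod_restrict]
    refine (MeasureTheory.ae_restrict_iff' (measurableSet_Ioi.prod measurableSet_Ioi)).mpr
      (Filter.Eventually.of_forall ?_)
    rintro ⟨x, t⟩ ⟨hx, ht⟩
    have hx : 0 < x := hx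
    have ht : 0 < t := ht
    have hpos := exp_two_pi_mul_sub_one_pos hx
    simp only [Function.uncurry]
    rw [Real.norm_eq_abs, abs_mul, abs_div, abs_div, abs_mul, Real.abs_exp, abs_of_pos hpos,
      abs_of_pos (pow_pos ht (n + 1)), abs_of_pos (two_pos : (0 : ℝ) < 2)]
    calc 2 / (Real.exp (2 * Real.pi * x) - 1)
          * (|Real.sin (x * t) - x * t| * Real.exp (-v * t) / t ^ (n + 1))
        ≤ 2 / (Real.exp (2 * Real.pi * x) - 1)
          * (x ^ 3 / 6 * t ^ 3 * Real.exp (-v * t) / t ^ (n + 1)) := by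
          gcongr
          exact abs_sin_mul_sub_le hx.le ht
      _ = _ := by ring

theorem laplaceMoment_boseKernel {v : ℝ} (hv : 0 < v) {n : ℕ} (hn : n < 3) :
    MeasureTheory.IntegrableOn (fun x : ℝ => 2 / (Real.exp (2 * Real.pi * x) - 1) *
      laplaceMoment (fun t => Real.sin (x * t) - x * t) v n) (Set.Ioi 0) ∧
    ∫ x in Set.Ioi (0 : ℝ), 2 / (Real.exp (2 * Real.pi * x) - 1) *
      laplaceMoment (fun t => Real.sin (x * t) - x * t) v n = laplaceMoment boseKernel v n := by
  have hint := integrable_boseKernel_prod hv hn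
  have e : ∀ x : ℝ, 2 / (Real.exp (2 * Real.pi * x) - 1) *
      laplaceMoment (fun t => Real.sin (x * t) - x * t) v n
      = ∫ t in Set.Ioi (0 : ℝ), 2 / (Real.exp (2 * Real.pi * x) - 1) *
        ((Real.sin (x * t) - x * t) * Real.exp (-v * t) / t ^ (n + 1)) := fun x => by
    rw [MeasureTheory.integral_const_mul, laplaceMoment]
  simp only [e]
  refine ⟨hint.integral_prod_left, ?_⟩
  rw [MeasureTheory.integral_integral_swap hint, laplaceMoment]
  refine MeasureTheory.setIntegral_congr_fun measurableSet_Ioi fun t ht => ?_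
  rw [boseKernel_eq_integral ht, mul_div_assoc, ← MeasureTheory.integral_mul_const]
  congr 1
  ext x
  ring

theorem integral_sq_mul_arctan_eq_laplaceMoment {v : ℝ} (hv : 0 < v) :
    MeasureTheory.IntegrableOn
      (fun x : ℝ => x ^ 2 * Real.arctan (x / v) / (Real.exp (2 * Real.pi * x) - 1))
      (Set.Ioi 0) ∧
    ∫ x in Set.Ioi (0 : ℝ), x ^ 2 * Real.arctan (x / v) / (Real.exp (2 * Real.pi * x) - 1)
      = -(laplaceMoment boseKernel v 2 + v * laplaceMoment boseKernel v 1
          + v ^ 2 / 2 * laplaceMoment boseKernel v 0) := by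
  set F : ℕ → ℝ → ℝ := fun n x => 2 / (Real.exp (2 * Real.pi * x) - 1) *
    laplaceMoment (fun t => Real.sin (x * t) - x * t) v n with hF
  have hn : ∀ n < 3, MeasureTheory.Integrable (F n) (MeasureTheory.volume.restrict (Set.Ioi 0)) ∧
      ∫ x in Set.Ioi (0 : ℝ), F n x = laplaceMoment boseKernel v n := fun n hn =>
    laplaceMoment_boseKernel hv hn
  have h0 := hn 0 (by norm_num)
  have h1 := hn 1 (by norm_num)
  have h2 := hn 2 (by norm_num)
  have i1 := h1.1.const_mul v
  have i0 := h0.1.const_mul (v ^ 2 / 2)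
  have i21 : MeasureTheory.Integrable (fun x => F 2 x + v * F 1 x)
    (MeasureTheory.volume.restrict (Set.Ioi 0)) := h2.1.add i1
  have i : MeasureTheory.IntegrableOn (fun x => -(F 2 x + v * F 1 x + v ^ 2 / 2 * F 0 x))
    (Set.Ioi 0) := (i21.add i0).neg
  have e : Set.EqOn (fun x => -(F 2 x + v * F 1 x + v ^ 2 / 2 * F 0 x))
      (fun x : ℝ => x ^ 2 * Real.arctan (x / v) / (Real.exp (2 * Real.pi * x) - 1))
      (Set.Ioi 0) := by
    intro x hx
    have h := laplaceMoment_sin hv hx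
    simp only [hF]
    linear_combination (-2 / (Real.exp (2 * Real.pi * x) - 1)) * h
  refine ⟨i.congr_fun e measurableSet_Ioi, ?_⟩
  rw [← MeasureTheory.setIntegral_congr_fun measurableSet_Ioi e, MeasureTheory.integral_neg,
    MeasureTheory.integral_add i21 i0, MeasureTheory.integral_add h2.1 i1,
    MeasureTheory.integral_const_mul, MeasureTheory.integral_const_mul, h0.2, h1.2, h2.2]

/-! ### The Hurwitz zeta function as a Mellin transform -/

theorem HasMellin.add {f g : ℝ → ℂ} {s a b : ℂ} (hf : HasMellin f s a) (hg : HasMellin g s b) :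
    HasMellin (fun t => f t + g t) s (a + b) := by
  have h := hasMellin_add hf.1 hg.1
  rwa [hf.2, hg.2] at h

theorem mellin_exp_div_one_sub_exp {v : ℝ} (hv : 0 < v) {s : ℂ} (hs : 1 < s.re) :
    mellin (fun t : ℝ => ((Real.exp (-v * t) / (1 - Real.exp (-t)) : ℝ) : ℂ)) s
      = Complex.Gamma s * hurwitzZetaPos v s := by
  have hp : ∀ n : ℕ, 0 < (n : ℝ) + v := fun n => by positivity
  have h := hasSum_mellin (a := fun _ : ℕ => (1 : ℂ)) (p := fun n : ℕ => (n : ℝ) + v)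
    (F := fun t : ℝ => ((Real.exp (-v * t) / (1 - Real.exp (-t)) : ℝ) : ℂ)) (s := s)
    (fun n => Or.inr (hp n)) (by linarith)
    (by
      intro t ht
      have hr : Real.exp (-t) < 1 := Real.exp_lt_one_iff.mpr (neg_lt_zero.mpr ht)
      have hg := (hasSum_geometric_of_lt_one (Real.exp_pos _).le hr).mul_left (Real.exp (-v * t))
      have hg' := Complex.hasSum_ofReal.mpr hg
      convert! hg' using 1
      ext n
      rw [one_mul, ← Real.exp_nat_mul, ← Real.exp_add]
      congr 2
      ring)
    (by
      have hz := (Real.summable_one_div_nat_add_rpow v s.re).mpr hs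
      refine hz.congr fun n => ?_
      rw [norm_one, abs_of_pos (hp n)])
  refine h.unique ?_
  have hz := (hasSum_hurwitzZetaPos hv hs).mul_left (Complex.Gamma s)
  convert! hz using 1
  ext n
  push_cast
  ring

/-- The Hurwitz zeta function with the leading terms of its large-`v` expansion removed. -/
noncomputable def hurwitzZetaRemainder (v : ℝ) (s : ℂ) : ℂ :=
  hurwitzZetaPos v s - (1 / 2) * (v : ℂ) ^ (-s) - (v : ℂ) ^ (-s) * v / (s - 1)
    - boseConst * (s * (v : ℂ) ^ (-s - 1))

/-- The terms 1/2, 1/t and ct removed from the kernel have transforms Γ(s)v^{-s}/2, Γ(s-1)v^{1-s}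
and cΓ(s+1)v^{-s-1}; these are Γ(s) times the terms removed from ζ(s, v). -/
theorem Gamma_mul_hurwitzZetaRemainder {v : ℝ} (hv : 0 < v) {s : ℂ} (hs : 1 < s.re) :
    Complex.Gamma s * hurwitzZetaRemainder v s
      = mellin (fun t : ℝ => ((boseKernel t * Real.exp (-v * t) : ℝ) : ℂ)) s := by
  have hv' : (v : ℂ) ≠ 0 := by exact_mod_cast hv.ne'
  have hvre : 0 < (v : ℂ).re := by simpa using hv
  have hs0 : s ≠ 0 := by rintro rfl; simp at hs; linarith
  have hs1 : s - 1 ≠ 0 := fun h => by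
    rw [sub_eq_zero] at h
    simp [h] at hs
  have h0 : HasMellin (fun t : ℝ => ((boseKernel t * Real.exp (-v * t) : ℝ) : ℂ)) s _ :=
    ⟨mellinConvergent_mul_exp_neg hv continuousOn_boseKernel (fun t ht => abs_boseKernel_le ht)
      (by linarith), rfl⟩
  have h1 := hasMellin_cexp_neg_mul (s := s) (by linarith) hvre
  have h2 := hasMellin_cpow_mul_cexp_neg_mul (s := s) (a := -1) (by simp; linarith) hvre
  have h3 := hasMellin_cpow_mul_cexp_neg_mul (s := s) (a := 1) (by simp; linarith) hvre
  have h := ((h0.add (h1.const_mul (1 / 2))).add h2).add (h3.const_mul boseConst)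
  have h' := h.congr (g := fun t : ℝ =>
      ((Real.exp (-v * t) / (1 - Real.exp (-t)) : ℝ) : ℂ)) (by
    intro t ht
    rw [Complex.cpow_neg_one, Complex.cpow_one, boseKernel]
    push_cast
    ring)
  have hfin := h'.2
  rw [mellin_exp_div_one_sub_exp hv hs, Complex.Gamma_add_one s hs0] at hfin
  have hG : Complex.Gamma s = (s - 1) * Complex.Gamma (s + -1) := by
    rw [← sub_eq_add_neg, ← Complex.Gamma_add_one (s - 1) hs1, sub_add_cancel]
  have hp : (v : ℂ) ^ (-(s + -1)) = (v : ℂ) ^ (-s) * v := by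
    rw [show -(s + -1) = -s + 1 by ring, Complex.cpow_add _ _ hv', Complex.cpow_one]
  rw [hp, show -(s + 1) = -s - 1 by ring] at hfin
  rw [hurwitzZetaRemainder, mul_sub, mul_sub, mul_sub, hfin]
  have : Complex.Gamma s * ((v : ℂ) ^ (-s) * v / (s - 1))
      = Complex.Gamma (s + -1) * ((v : ℂ) ^ (-s) * v) := by
    rw [hG]
    field_simp
  rw [this]
  ring

theorem differentiableAt_hurwitzZetaRemainder {v : ℝ} (hv : 0 < v) {s : ℂ} (hs : s ≠ 1) :
    DifferentiableAt ℂ (hurwitzZetaRemainder v) s := by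
  have hv' : (v : ℂ) ≠ 0 := by exact_mod_cast hv.ne'
  have hd := (hasDerivAt_cpow_neg hv' s).differentiableAt
  unfold hurwitzZetaRemainder
  refine (((differentiableAt_hurwitzZetaPos hv hs).sub (hd.const_mul _)).sub ?_).sub ?_
  · exact (hd.mul_const _).div (by fun_prop) (sub_ne_zero.mpr hs)
  · refine ((differentiableAt_id).mul ?_).const_mul _
    exact DifferentiableAt.const_cpow (by fun_prop) (Or.inl hv')

/-- The leading terms of the derivative of the Hurwitz zeta function at `s = -n`. -/
noncomputable def hurwitzDerivMain (v : ℝ) (n : ℕ) : ℝ :=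
  -(v ^ n * Real.log v / 2) + v ^ (n + 1) * (Real.log v / (n + 1) - 1 / (n + 1) ^ 2)
    + boseConst * (v ^ n / v * (1 + n * Real.log v))

theorem deriv_hurwitzZetaPos_neg_nat {v : ℝ} (hv : 0 < v) {n : ℕ} (hn : n < 3) :
    deriv (hurwitzZetaPos v) (-(n : ℂ))
      = ((hurwitzDerivMain v n + (-1) ^ n * n.factorial * laplaceMoment boseKernel v n : ℝ) : ℂ)
      := by
  have hv' : (v : ℂ) ≠ 0 := by exact_mod_cast hv.ne'
  have hn1 : -(n : ℂ) - 1 ≠ 0 := by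
    have : (0 : ℝ) < n + 1 := by positivity
    have h : (n : ℂ) + 1 ≠ 0 := by exact_mod_cast this.ne'
    intro h'
    exact h (by linear_combination -h')
  have hn2 : (n : ℂ) + 1 ≠ 0 := fun h => hn1 (by linear_combination -h)
  have hR := hasDerivAt_of_eq_mellin_div_Gamma hv continuousOn_boseKernel
    (fun t ht => abs_boseKernel_le ht)
    (fun s hs => differentiableAt_hurwitzZetaRemainder hv hs)
    (fun s hs => Gamma_mul_hurwitzZetaRemainder hv hs) hn
  have hd := hasDerivAt_cpow_neg_neg_nat hv' n
  have h1 := hd.const_mul (1 / 2 : ℂ)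
  have h2 := (hd.mul_const (v : ℂ)).div ((hasDerivAt_id (-(n : ℂ))).sub_const 1) hn1
  have h3 := (hasDerivAt_mul_cpow_neg_sub_one hv' n).const_mul (boseConst : ℂ)
  have h := ((hR.add h1).add h2).add h3
  have h' : HasDerivAt (hurwitzZetaPos v) _ (-(n : ℂ)) := h.congr_of_eventuallyEq
    (Filter.Eventually.of_forall fun s => by
      simp only [Pi.add_apply, Pi.div_apply, id, hurwitzZetaRemainder]
      ring)
  rw [h'.deriv, neg_neg, Complex.cpow_natCast, hurwitzDerivMain, ← Complex.ofReal_log hv.le]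
  push_cast
  simp only [id]
  field_simp
  ring

/-! ### Difference equation and limit formula in v -/

theorem hurwitzZetaPos_add_one {v : ℝ} (hv : 0 < v) (s : ℂ) :
    hurwitzZetaPos (v + 1) s = hurwitzZetaPos v s - 1 / (v : ℂ) ^ s := by
  have hpos : 0 < ⌈v⌉₊ := Nat.ceil_pos.mpr hv
  have h1 : ⌈v + 1⌉₊ - 1 = (⌈v⌉₊ - 1) + 1 := by
    rw [Nat.ceil_add_one hv.le]
    omega
  unfold hurwitzZetaPos
  rw [h1]
  generalize ⌈v⌉₊ - 1 = N
  have h2 : v + 1 - ((N + 1 : ℕ) : ℝ) = v - N := by push_cast; ring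
  rw [h2, Finset.sum_range_succ, ← sub_sub]
  congr 3
  push_cast
  ring

theorem hurwitzZetaPos_one : hurwitzZetaPos 1 = riemannZeta := by
  ext s
  rw [← HurwitzZeta.hurwitzZeta_zero]
  simp only [hurwitzZetaPos, Nat.ceil_one, Nat.sub_self, Nat.cast_zero, sub_zero,
    Finset.range_zero, Finset.sum_empty]
  rw [show ((1 : ℝ) : UnitAddCircle) = 0 from AddCircle.coe_period 1]

/-- The real number `ζ'(-n, v)`. -/
noncomputable def hurwitzDeriv (v : ℝ) (n : ℕ) : ℝ :=
  hurwitzDerivMain v n + (-1) ^ n * n.factorial * laplaceMoment boseKernel v n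

theorem hurwitzDeriv_add_one {v : ℝ} (hv : 0 < v) {n : ℕ} (hn : n < 3) :
    hurwitzDeriv (v + 1) n = hurwitzDeriv v n + v ^ n * Real.log v := by
  have hv' : (v : ℂ) ≠ 0 := by exact_mod_cast hv.ne'
  have h1 := deriv_hurwitzZetaPos_neg_nat hv hn
  have h2 := deriv_hurwitzZetaPos_neg_nat (show 0 < v + 1 by linarith) hn
  have hne : -(n : ℂ) ≠ 1 := by
    intro h
    have h' := congrArg Complex.re h
    simp only [Complex.neg_re, Complex.natCast_re, Complex.one_re] at h'
    have : (0 : ℝ) ≤ n := n.cast_nonneg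
    linarith
  have hd := (differentiableAt_hurwitzZetaPos hv hne).hasDerivAt.sub
    (hasDerivAt_cpow_neg_neg_nat hv' n)
  have h3 : HasDerivAt (hurwitzZetaPos (v + 1)) _ (-(n : ℂ)) := hd.congr_of_eventuallyEq
    (Filter.Eventually.of_forall fun s => by
      rw [hurwitzZetaPos_add_one hv, Pi.sub_apply, Complex.cpow_neg, one_div])
  rw [h3.deriv, h1, ← Complex.ofReal_log hv.le] at h2
  have : ((hurwitzDeriv (v + 1) n : ℝ) : ℂ)
      = ((hurwitzDeriv v n + v ^ n * Real.log v : ℝ) : ℂ) := by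
    rw [hurwitzDeriv, ← h2, hurwitzDeriv]
    push_cast
    ring
  exact_mod_cast this

theorem hurwitzDeriv_add_nat {v : ℝ} (hv : 0 < v) {n : ℕ} (hn : n < 3) (N : ℕ) :
    hurwitzDeriv (v + N) n
      = hurwitzDeriv v n + ∑ k ∈ Finset.range N, (v + k) ^ n * Real.log (v + k) := by
  induction N with
  | zero => simp
  | succ N ih =>
    rw [Finset.sum_range_succ, ← add_assoc, ← ih,
      ← hurwitzDeriv_add_one (show 0 < v + (N : ℝ) by positivity) hn]
    push_cast
    rw [add_assoc]

/-- The cubic bound gives the majorant C Γ(3-n) v^{n-3}. -/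
theorem tendsto_laplaceMoment_boseKernel {n : ℕ} (hn : n < 3) :
    Filter.Tendsto (fun v => laplaceMoment boseKernel v n) Filter.atTop (nhds 0) := by
  set C := 1 / 3 * ∫ x in Set.Ioi (0 : ℝ), x ^ 3 / (Real.exp (2 * Real.pi * x) - 1) with hC
  have hn' : (n : ℝ) < 3 := by exact_mod_cast hn
  have hlim : Filter.Tendsto (fun v : ℝ => C * ((1 / v) ^ (3 - n : ℝ) * Real.Gamma (3 - n)))
      Filter.atTop (nhds 0) := by
    have h1 : Filter.Tendsto (fun v : ℝ => (v⁻¹) ^ (3 - n : ℝ)) Filter.atTop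
        (nhds ((0 : ℝ) ^ (3 - n : ℝ))) :=
      tendsto_inv_atTop_zero.rpow_const (Or.inr (by linarith))
    rw [Real.zero_rpow (by linarith)] at h1
    have h2 := (h1.mul_const (Real.Gamma (3 - n))).const_mul C
    simpa only [one_div, zero_mul, mul_zero] using h2
  refine squeeze_zero_norm' ?_ hlim
  filter_upwards [Filter.eventually_gt_atTop 0] with v hv
  rw [← Real.integral_rpow_mul_exp_neg_mul_Ioi (by linarith) hv,
    ← MeasureTheory.integral_const_mul]
  unfold laplaceMoment
  have hi := integrableOn_rpow_mul_exp_neg_mul (σ := 3 - (n : ℝ)) (b := v) (by linarith) hv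
  simp only [neg_mul] at hi
  refine MeasureTheory.norm_integral_le_of_norm_le (hi.const_mul C) ?_
  refine (MeasureTheory.ae_restrict_iff' measurableSet_Ioi).mpr (Filter.Eventually.of_forall ?_)
  intro t ht
  have ht : 0 < t := ht
  have e : t ^ (3 - (n : ℝ) - 1) = t ^ 3 / t ^ (n + 1) := by
    rw [show 3 - (n : ℝ) - 1 = ((3 : ℕ) : ℝ) - ((n + 1 : ℕ) : ℝ) by push_cast; ring,
      Real.rpow_sub ht, Real.rpow_natCast, Real.rpow_natCast]
  rw [Real.norm_eq_abs, abs_div, abs_mul, Real.abs_exp, abs_of_pos (pow_pos ht (n + 1)), e, neg_mul]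
  calc |boseKernel t| * Real.exp (-(v * t)) / t ^ (n + 1)
      ≤ C * t ^ 3 * Real.exp (-(v * t)) / t ^ (n + 1) := by
        gcongr
        exact abs_boseKernel_le ht
    _ = _ := by ring

/-- Shifting v by N adds a finite sum to ζ'(-n, v), while the Laplace moment at v + N tends to 0;
only the elementary main term survives. -/
theorem tendsto_hurwitzDerivMain_sub_sum {v : ℝ} (hv : 0 < v) {n : ℕ} (hn : n < 3) :
    Filter.Tendsto (fun N : ℕ => hurwitzDerivMain (v + N) n
        - ∑ k ∈ Finset.range N, (v + k) ^ n * Real.log (v + k))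
      Filter.atTop (nhds (hurwitzDeriv v n)) := by
  have h1 : Filter.Tendsto (fun N : ℕ => v + (N : ℝ)) Filter.atTop Filter.atTop :=
    Filter.tendsto_atTop_add_const_left _ _ tendsto_natCast_atTop_atTop
  have h2 := ((tendsto_laplaceMoment_boseKernel hn).comp h1).const_mul
    ((-1) ^ n * (n.factorial : ℝ))
  have h3 := (tendsto_const_nhds (x := hurwitzDeriv v n)).sub h2
  rw [mul_zero, sub_zero] at h3
  refine h3.congr fun N => ?_
  have h := hurwitzDeriv_add_nat hv hn N
  rw [hurwitzDeriv] at h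
  simp only [Function.comp_apply]
  linarith

theorem hurwitzDeriv_one_zero : hurwitzDeriv 1 0 = -Real.log (2 * Real.pi) / 2 := by
  have h := deriv_hurwitzZetaPos_neg_nat one_pos (n := 0) (by norm_num)
  rw [Nat.cast_zero, neg_zero, hurwitzZetaPos_one, deriv_riemannZeta_zero] at h
  have h2 : ((hurwitzDeriv 1 0 : ℝ) : ℂ) = ((-Real.log (2 * Real.pi) / 2 : ℝ) : ℂ) := by
    rw [hurwitzDeriv, ← h]
    push_cast
    rw [Complex.ofReal_log (by positivity)]
    push_cast
    ring
  exact_mod_cast h2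

/-! ### Asymptotics of the main terms -/

theorem tendsto_sq_mul_log_one_add_div (v : ℝ) :
    Filter.Tendsto (fun x : ℝ => x ^ 2 * Real.log (1 + v / x) - x * v) Filter.atTop
      (nhds (-(v ^ 2 / 2))) := by
  rw [tendsto_iff_norm_sub_tendsto_zero]
  have hlim : Filter.Tendsto (fun x : ℝ => 2 * |v| ^ 3 * x⁻¹) Filter.atTop (nhds 0) := by
    have h := (tendsto_inv_atTop_zero (𝕜 := ℝ)).const_mul (2 * |v| ^ 3)
    rwa [mul_zero] at h
  refine squeeze_zero' (Filter.Eventually.of_forall fun x => norm_nonneg _) ?_ hlim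
  filter_upwards [Filter.eventually_gt_atTop 0, Filter.eventually_ge_atTop (2 * |v|)]
    with x hx hxv
  have hy : |-(v / x)| ≤ 1 / 2 := by
    rw [abs_neg, abs_div, abs_of_pos hx, div_le_div_iff₀ hx two_pos]
    linarith
  have h := Real.abs_log_sub_add_sum_range_le (lt_of_le_of_lt hy (by norm_num)) 2
  have e : x ^ 2 * Real.log (1 + v / x) - x * v - -(v ^ 2 / 2)
      = x ^ 2 * ((∑ i ∈ Finset.range 2, (-(v / x)) ^ (i + 1) / ((i : ℝ) + 1))
        + Real.log (1 - (-(v / x)))) := by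
    simp only [Finset.sum_range_succ, Finset.sum_range_zero, sub_neg_eq_add]
    push_cast
    field_simp
    ring
  have h2 : |(-(v / x))| ^ (2 + 1) / (1 - |(-(v / x))|) ≤ 2 * (|v| ^ 3 / x ^ 3) := by
    rw [div_le_iff₀ (by linarith)]
    have : |(-(v / x))| ^ (2 + 1) = |v| ^ 3 / x ^ 3 := by
      rw [abs_neg, abs_div, abs_of_pos hx, div_pow]
    rw [this]
    have hp : 0 ≤ |v| ^ 3 / x ^ 3 := by positivity
    nlinarith
  rw [e, Real.norm_eq_abs, abs_mul, abs_of_pos (pow_pos hx 2)]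
  calc x ^ 2 * _ ≤ x ^ 2 * (2 * (|v| ^ 3 / x ^ 3)) :=
        mul_le_mul_of_nonneg_left (h.trans h2) (by positivity)
    _ = 2 * |v| ^ 3 * x⁻¹ := by field_simp

theorem tendsto_mul_log_one_add_div (v : ℝ) :
    Filter.Tendsto (fun x : ℝ => x * Real.log (1 + v / x)) Filter.atTop (nhds v) := by
  have h := ((tendsto_sq_mul_log_one_add_div v).mul tendsto_inv_atTop_zero).add_const v
  rw [mul_zero, zero_add] at h
  refine h.congr' ?_
  filter_upwards [Filter.eventually_gt_atTop 0] with x hx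
  field_simp
  ring

theorem tendsto_log_one_add_div (v : ℝ) :
    Filter.Tendsto (fun x : ℝ => Real.log (1 + v / x)) Filter.atTop (nhds 0) := by
  have h := (tendsto_mul_log_one_add_div v).mul tendsto_inv_atTop_zero
  rw [mul_zero] at h
  refine h.congr' ?_
  filter_upwards [Filter.eventually_gt_atTop 0] with x hx
  field_simp

theorem log_add_eq {v x : ℝ} (hv : 0 < v) (hx : 0 < x) :
    Real.log (x + v) = Real.log x + Real.log (1 + v / x) := by
  rw [← Real.log_mul hx.ne' (by positivity)]
  congr 1
  field_simp

theorem tendsto_hurwitzDerivMain_zero {v : ℝ} (hv : 0 < v) :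
    Filter.Tendsto (fun x : ℝ => hurwitzDerivMain (x + v) 0 - hurwitzDerivMain x 0
      - v * Real.log x) Filter.atTop (nhds 0) := by
  have h1 := tendsto_mul_log_one_add_div v
  have h2 := (tendsto_log_one_add_div v).const_mul (v - 1 / 2)
  have h3 : Filter.Tendsto (fun x : ℝ => boseConst * (x + v)⁻¹ - boseConst * x⁻¹) Filter.atTop
      (nhds (boseConst * 0 - boseConst * 0)) :=
    ((tendsto_inv_atTop_zero.comp (Filter.tendsto_atTop_add_const_right _ v
      Filter.tendsto_id)).const_mul _).sub (tendsto_inv_atTop_zero.const_mul _)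
  have h := ((h1.add h2).add h3).sub_const v
  rw [show v + (v - 1 / 2) * 0 + (boseConst * 0 - boseConst * 0) - v = 0 by ring] at h
  refine h.congr' ?_
  filter_upwards [Filter.eventually_gt_atTop 0] with x hx
  simp only [hurwitzDerivMain, log_add_eq hv hx]
  push_cast
  ring

/-- The subtracted terms match the comparison with G at x = m + 1: the main term of order 0 stands
for log m!, (v²/2) log x is the net logarithm left by Γ and the harmonic numbers, and v(x - 1) = vm
comes from the factors e^{-v}. -/
theorem tendsto_hurwitzDerivMain_one {v : ℝ} (hv : 0 < v) :
    Filter.Tendsto (fun x : ℝ => hurwitzDerivMain (x + v) 1 - hurwitzDerivMain x 1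
      - v ^ 2 / 2 * Real.log x - v * hurwitzDerivMain x 0 - v * (x - 1) - (v ^ 2 + v) / 2)
      Filter.atTop (nhds 0) := by
  have h0 := (tendsto_sq_mul_log_one_add_div v).const_mul (1 / 2)
  have h1 := (tendsto_mul_log_one_add_div v).const_mul (v - 1 / 2)
  have h2 := (tendsto_log_one_add_div v).const_mul (v ^ 2 / 2 - v / 2 + boseConst)
  have h3 := (tendsto_inv_atTop_zero (𝕜 := ℝ)).const_mul (v * boseConst)
  have h := (((h0.add h1).add h2).sub h3).sub_const (3 / 4 * v ^ 2 - v / 2)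
  rw [show 1 / 2 * (-(v ^ 2 / 2)) + (v - 1 / 2) * v + (v ^ 2 / 2 - v / 2 + boseConst) * 0
    - v * boseConst * 0 - (3 / 4 * v ^ 2 - v / 2) = 0 by ring] at h
  refine h.congr' ?_
  filter_upwards [Filter.eventually_gt_atTop 0] with x hx
  have hxv : x + v ≠ 0 := by positivity
  simp only [hurwitzDerivMain, log_add_eq hv hx, pow_one, pow_zero, div_self hx.ne', div_self hxv]
  push_cast
  ring

theorem sum_log_one_add_eq_log_factorial (m : ℕ) :
    ∑ k ∈ Finset.range m, Real.log (1 + k) = Real.log m.factorial := by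
  induction m with
  | zero => simp
  | succ m ih =>
    rw [Finset.sum_range_succ, ih, Nat.factorial_succ, Nat.cast_mul,
      Real.log_mul (by positivity) (by positivity)]
    push_cast
    rw [add_comm (1 : ℝ), add_comm]

theorem tendsto_hurwitzDerivMain_sub_sum_succ {v : ℝ} (hv : 0 < v) {n : ℕ} (hn : n < 3) :
    Filter.Tendsto (fun m : ℕ => hurwitzDerivMain ((m : ℝ) + 1 + v) n
        - ∑ k ∈ Finset.range (m + 1), (v + k) ^ n * Real.log (v + k))
      Filter.atTop (nhds (hurwitzDeriv v n)) := by
  have h := (tendsto_hurwitzDerivMain_sub_sum hv hn).comp (Filter.tendsto_add_atTop_nat 1)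
  refine h.congr fun m => ?_
  simp only [Function.comp_apply]
  rw [add_comm ((m : ℝ) + 1) v]
  push_cast
  rfl

theorem tendsto_hurwitzDerivMain_sub_log_factorial :
    Filter.Tendsto (fun m : ℕ => hurwitzDerivMain ((m : ℝ) + 1) 0 - Real.log m.factorial)
      Filter.atTop (nhds (hurwitzDeriv 1 0)) := by
  refine (tendsto_hurwitzDerivMain_sub_sum one_pos (n := 0) (by norm_num)).congr fun m => ?_
  simp only [pow_zero, one_mul]
  rw [sum_log_one_add_eq_log_factorial, add_comm (1 : ℝ)]

theorem tendsto_natCast_add_one_atTop :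
    Filter.Tendsto (fun m : ℕ => (m : ℝ) + 1) Filter.atTop Filter.atTop :=
  Filter.tendsto_atTop_add_const_right _ _ tendsto_natCast_atTop_atTop

/-! ### Identification with log Γ and log G -/

/-- Lerch's formula for `ζ'(0, v)`. -/
theorem hurwitzDeriv_zero {v : ℝ} (hv : 0 < v) :
    hurwitzDeriv v 0 = Real.log (Real.Gamma v) - Real.log (2 * Real.pi) / 2 := by
  have l1 := tendsto_hurwitzDerivMain_sub_sum_succ hv (n := 0) (by norm_num)
  have l2 := tendsto_hurwitzDerivMain_sub_log_factorial
  have l3 := Real.BohrMollerup.tendsto_log_gamma hv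
  have l4 := (tendsto_hurwitzDerivMain_zero hv).comp tendsto_natCast_add_one_atTop
  have l5 := Real.tendsto_log_nat_add_one_sub_log.const_mul v
  have h := (((l1.sub l2).sub l3).sub l4).sub l5
  have hz : Filter.Tendsto (fun _ : ℕ => (0 : ℝ)) Filter.atTop (nhds 0) := tendsto_const_nhds
  -- The combination of sequences vanishes identically in m, so the same combination of limits is 0.
  have h' := tendsto_nhds_unique (h.congr (f₂ := fun _ : ℕ => (0 : ℝ)) fun m => by
    simp only [Function.comp_apply, Real.BohrMollerup.logGammaSeq, pow_zero, one_mul]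
    ring) hz
  rw [hurwitzDeriv_one_zero] at h'
  linarith

theorem log_barnesG_one_add {v : ℝ} (hv : 0 < v) :
    Real.log (barnesG (1 + v)) = v / 2 * Real.log (2 * Real.pi)
      - (Real.eulerMascheroniConstant * v ^ 2 + v ^ 2 + v) / 2
      + ∑' k : ℕ, Real.log ((1 + v / ((k : ℝ) + 1)) ^ (k + 1)
        * Real.exp (v ^ 2 / (2 * ((k : ℝ) + 1)) - v)) := by
  have hs := summable_log_barnesG (show 0 < 1 + v by linarith)
  unfold barnesG
  rw [← Real.rexp_tsum_eq_tprod hs.1 hs.2, add_sub_cancel_left,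
    Real.log_mul (by positivity) (by positivity), Real.log_mul (by positivity) (by positivity),
    Real.log_rpow (by positivity), Real.log_exp, Real.log_exp]
  ring

theorem sum_log_barnesG_factor {v : ℝ} (hv : 0 < v) (m : ℕ) :
    ∑ k ∈ Finset.range m, Real.log ((1 + v / ((k : ℝ) + 1)) ^ (k + 1)
        * Real.exp (v ^ 2 / (2 * ((k : ℝ) + 1)) - v))
      = ∑ k ∈ Finset.range m, ((k : ℝ) + 1) * Real.log (v + ((k : ℝ) + 1))
        - ∑ k ∈ Finset.range m, (1 + (k : ℝ)) * Real.log (1 + k)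
        + v ^ 2 / 2 * (harmonic m : ℝ) - m * v := by
  induction m with
  | zero => simp
  | succ m ih =>
    have hm : (0 : ℝ) < (m : ℝ) + 1 := by positivity
    rw [Finset.sum_range_succ, ih, Finset.sum_range_succ, Finset.sum_range_succ, harmonic_succ,
      Real.log_mul (by positivity) (by positivity), Real.log_pow, Real.log_exp,
      show 1 + v / ((m : ℝ) + 1) = (v + ((m : ℝ) + 1)) / ((m : ℝ) + 1) by field_simp; ring,
      Real.log_div (by positivity) hm.ne', add_comm (1 : ℝ) m]
    push_cast
    field_simp
    ring

/-- The limit formulas at v and 1 are compared with the Gauss limit, the partial products of G, the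
limits defining ζ'(0) and γ. All m-dependence cancels, leaving (v² + v)/2, which the exponential
prefactor of G absorbs along with γv²/2. -/
theorem hurwitzDeriv_one {v : ℝ} (hv : 0 < v) :
    hurwitzDeriv v 1 = hurwitzDeriv 1 1 + v * Real.log (Real.Gamma v)
      - Real.log (barnesG (1 + v)) := by
  have hs := summable_log_barnesG (show 0 < 1 + v by linarith)
  simp only [add_sub_cancel_left] at hs
  have lA := tendsto_hurwitzDerivMain_sub_sum_succ hv (n := 1) (by norm_num)
  have lB := tendsto_hurwitzDerivMain_sub_sum one_pos (n := 1) (by norm_num)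
  have lC := (Real.BohrMollerup.tendsto_log_gamma hv).const_mul v
  have lD := hs.2.hasSum.tendsto_sum_nat
  have lE := tendsto_hurwitzDerivMain_sub_log_factorial.const_mul v
  have lF := Real.tendsto_harmonic_sub_log.const_mul (v ^ 2 / 2)
  have lG := Real.tendsto_log_nat_add_one_sub_log.const_mul (v ^ 2 / 2)
  have lH := (tendsto_hurwitzDerivMain_one hv).comp tendsto_natCast_add_one_atTop
  have h := (((((((lA.sub lB).sub lC).add lD).sub lE).sub lF).sub lG).sub lH)
  have hz : Filter.Tendsto (fun _ : ℕ => (v ^ 2 + v) / 2) Filter.atTop (nhds ((v ^ 2 + v) / 2)) :=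
    tendsto_const_nhds
  have h' := tendsto_nhds_unique (h.congr (f₂ := fun _ : ℕ => (v ^ 2 + v) / 2) fun m => by
    -- In (v + k) log(v + k), the v part feeds Γ and the k part feeds G; the k = 0 term of the
    -- latter is zero, which explains the shift.
    have e1 : ∑ k ∈ Finset.range (m + 1), (v + (k : ℝ)) * Real.log (v + k)
        = v * ∑ k ∈ Finset.range (m + 1), Real.log (v + k)
          + ∑ k ∈ Finset.range m, ((k : ℝ) + 1) * Real.log (v + ((k : ℝ) + 1)) := by
      simp only [add_mul, Finset.sum_add_distrib, ← Finset.mul_sum]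
      rw [Finset.sum_range_succ' (fun k : ℕ => (k : ℝ) * Real.log (v + k))]
      push_cast
      simp only [add_mul, Finset.sum_add_distrib, one_mul, zero_mul, add_zero]
    simp only [Function.comp_apply, Real.BohrMollerup.logGammaSeq, pow_one]
    rw [sum_log_barnesG_factor hv, e1, add_comm (1 : ℝ) m]
    ring) hz
  rw [hurwitzDeriv_one_zero] at h'
  rw [log_barnesG_one_add hv]
  linarith

/-! ### The value ζ'(-2) and the final assembly -/

/-- In the functional equation at s = 3 the factor cos(πs/2) vanishes, so only its derivative π/2
contributes. -/
theorem deriv_riemannZeta_neg_two :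
    deriv riemannZeta (-2) = -riemannZeta 3 / (4 * (Real.pi : ℂ) ^ 2) := by
  have hπ : (Real.pi : ℂ) ≠ 0 := by exact_mod_cast Real.pi_pos.ne'
  have h2π : (2 * Real.pi : ℂ) ≠ 0 := mul_ne_zero two_ne_zero hπ
  have hcos : HasDerivAt (fun s : ℂ => Complex.cos (Real.pi * s / 2)) (Real.pi / 2) 3 := by
    have h1 : HasDerivAt (fun s : ℂ => (Real.pi : ℂ) * s / 2) (Real.pi / 2) 3 := by
      simpa using ((hasDerivAt_id (3 : ℂ)).const_mul (Real.pi : ℂ)).div_const 2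
    have h2 := h1.ccos
    have : Complex.sin ((Real.pi : ℂ) * 3 / 2) = -1 := by
      rw [show (Real.pi : ℂ) * 3 / 2 = Real.pi / 2 + Real.pi by ring, Complex.sin_add_pi,
        Complex.sin_pi_div_two]
    rw [this] at h2
    simpa using h2
  have hcos0 : Complex.cos ((Real.pi : ℂ) * 3 / 2) = 0 := by
    rw [show (Real.pi : ℂ) * 3 / 2 = Real.pi / 2 + Real.pi by ring, Complex.cos_add_pi,
      Complex.cos_pi_div_two, neg_zero]
  have hA : DifferentiableAt ℂ (fun s : ℂ => 2 * (2 * (Real.pi : ℂ)) ^ (-s) * Complex.Gamma s) 3 := by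
    refine ((hasDerivAt_cpow_neg h2π 3).differentiableAt.const_mul 2).mul ?_
    refine Complex.differentiableAt_Gamma _ fun m h => ?_
    have h' := congrArg Complex.re h
    simp only [Complex.neg_re, Complex.natCast_re, Complex.re_ofNat] at h'
    have : (0 : ℝ) ≤ m := m.cast_nonneg
    linarith
  have hZ : DifferentiableAt ℂ riemannZeta 3 := differentiableAt_riemannZeta (by norm_num)
  have hprod := (hA.hasDerivAt.mul hcos).mul hZ.hasDerivAt
  have hL : HasDerivAt (fun s : ℂ => riemannZeta (1 - s)) (-deriv riemannZeta (-2)) 3 := by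
    have h1 : DifferentiableAt ℂ riemannZeta (-2) := differentiableAt_riemannZeta (by norm_num)
    have h2 : HasDerivAt riemannZeta (deriv riemannZeta (-2)) (1 - 3) := by
      convert! h1.hasDerivAt using 1
      norm_num
    exact h2.comp_const_sub 1 3
  have hE : (fun s : ℂ => riemannZeta (1 - s)) =ᶠ[nhds 3] fun s : ℂ =>
      2 * (2 * (Real.pi : ℂ)) ^ (-s) * Complex.Gamma s * Complex.cos (Real.pi * s / 2)
        * riemannZeta s := by
    have : {s : ℂ | 1 < s.re} ∈ nhds (3 : ℂ) :=
      (isOpen_lt continuous_const Complex.continuous_re).mem_nhds (by simp)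
    filter_upwards [this] with s hs
    have hs : 1 < s.re := hs
    refine riemannZeta_one_sub (fun n h => ?_) (fun h => ?_)
    · rw [h] at hs
      simp only [Complex.neg_re, Complex.natCast_re] at hs
      have : (0 : ℝ) ≤ n := n.cast_nonneg
      linarith
    · rw [h] at hs
      simp at hs
  have hu := hL.unique (hprod.congr_of_eventuallyEq hE)
  simp only [Pi.mul_apply, hcos0] at hu
  have hG : Complex.Gamma 3 = 2 := by
    have := Complex.Gamma_nat_eq_factorial 2
    rw [show ((2 : ℕ) : ℂ) + 1 = 3 by norm_num] at this
    rw [this]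
    norm_num [Nat.factorial]
  have hp : (2 * (Real.pi : ℂ)) ^ (-3 : ℂ) = ((2 * (Real.pi : ℂ)) ^ 3)⁻¹ := by
    rw [Complex.cpow_neg]
    norm_cast
  rw [hG, hp] at hu
  have : deriv riemannZeta (-2) = -(2 * ((2 * (Real.pi : ℂ)) ^ 3)⁻¹ * 2 * (Real.pi / 2)
      * riemannZeta 3) := by
    linear_combination -hu
  rw [this]
  field_simp
  ring

theorem integral_sq_mul_arctan {v : ℝ} (hv : 0 < v) :
    ∫ x in Set.Ioi (0 : ℝ), x ^ 2 * Real.arctan (x / v) / (Real.exp (2 * Real.pi * x) - 1)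
      = v ^ 3 * Real.log v / 6 - 11 * v ^ 3 / 36 + v ^ 2 * Real.log (Real.Gamma v) / 2
        + v ^ 2 * Real.log (2 * Real.pi) / 4 + v * hurwitzDeriv 1 1 - hurwitzDeriv v 2 / 2
        - v * Real.log (barnesG (1 + v)) := by
  rw [(integral_sq_mul_arctan_eq_laplaceMoment hv).2]
  have h0 := hurwitzDeriv_zero hv
  have h1 := hurwitzDeriv_one hv
  have d0 : hurwitzDeriv v 0 = hurwitzDerivMain v 0 + laplaceMoment boseKernel v 0 := by
    simp [hurwitzDeriv]
  have d1 : hurwitzDeriv v 1 = hurwitzDerivMain v 1 - laplaceMoment boseKernel v 1 := by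
    simp [hurwitzDeriv, sub_eq_add_neg]
  have d2 : hurwitzDeriv v 2 = hurwitzDerivMain v 2 + 2 * laplaceMoment boseKernel v 2 := by
    simp [hurwitzDeriv]
  -- In this combination the `boseConst` terms and the v² log v terms cancel.
  have hm : hurwitzDerivMain v 2 / 2 - v * hurwitzDerivMain v 1 + v ^ 2 / 2 * hurwitzDerivMain v 0
      = v ^ 3 * Real.log v / 6 - 11 * v ^ 3 / 36 := by
    simp only [hurwitzDerivMain]
    field_simp
    push_cast
    ring
  linear_combination hm + (1 / 2) * d2 - v * (d1 - h1) + v ^ 2 / 2 * (d0 - h0)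

theorem mainTheorem5 :
    (∀ v : ℝ, 0 < v →
      MeasureTheory.IntegrableOn
        (fun x : ℝ => x ^ 2 * Real.arctan (x / v) / (Real.exp (2 * Real.pi * x) - 1))
        (Set.Ioi 0) ∧
      ((∫ x in Set.Ioi (0 : ℝ),
          x ^ 2 * Real.arctan (x / v) / (Real.exp (2 * Real.pi * x) - 1) : ℝ) : ℂ) =
        ((v ^ 3 * Real.log v / 6 - 11 * v ^ 3 / 36
            + v ^ 2 * Real.log (Real.Gamma v) / 2
            + v ^ 2 * Real.log (2 * Real.pi) / 4 : ℝ) : ℂ)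
          + (v : ℂ) * deriv riemannZeta (-1)
          - deriv (hurwitzZetaPos v) (-2) / 2
          - ((v * Real.log (barnesG (1 + v)) : ℝ) : ℂ)) ∧
    (MeasureTheory.IntegrableOn
        (fun x : ℝ => x ^ 2 * Real.arctan x / (Real.exp (2 * Real.pi * x) - 1))
        (Set.Ioi 0) ∧
      ((∫ x in Set.Ioi (0 : ℝ),
          x ^ 2 * Real.arctan x / (Real.exp (2 * Real.pi * x) - 1) : ℝ) : ℂ) =
        ((-11 / 36 + Real.log (2 * Real.pi) / 4 : ℝ) : ℂ)
          + deriv riemannZeta (-1)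
          + riemannZeta 3 / (8 * (Real.pi : ℂ) ^ 2)) := by
  have hz1 : deriv riemannZeta (-1) = (hurwitzDeriv 1 1 : ℂ) := by
    have h := deriv_hurwitzZetaPos_neg_nat one_pos (n := 1) (by norm_num)
    rwa [hurwitzZetaPos_one, Nat.cast_one] at h
  have hz2 : ∀ v : ℝ, 0 < v → deriv (hurwitzZetaPos v) (-2) = (hurwitzDeriv v 2 : ℂ) := by
    intro v hv
    have h := deriv_hurwitzZetaPos_neg_nat hv (n := 2) (by norm_num)
    rwa [Nat.cast_ofNat] at h
  refine ⟨fun v hv => ⟨(integral_sq_mul_arctan_eq_laplaceMoment hv).1, ?_⟩, ?_, ?_⟩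
  · rw [integral_sq_mul_arctan hv, hz1, hz2 v hv]
    push_cast
    ring
  · simpa only [div_one] using (integral_sq_mul_arctan_eq_laplaceMoment one_pos).1
  · have h := integral_sq_mul_arctan one_pos
    -- At v = 1 the formula for ζ'(-1, v) has ζ'(-1) on both sides and log Γ(1) = 0, which forces
    -- log G(2) = 0 without evaluating the product.
    have hG : Real.log (barnesG (1 + 1)) = 0 := by
      have h1 := hurwitzDeriv_one one_pos
      rw [Real.Gamma_one, Real.log_one] at h1
      linarith
    have hz : (hurwitzDeriv 1 2 : ℂ) = -riemannZeta 3 / (4 * (Real.pi : ℂ) ^ 2) := by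
      rw [← hz2 1 one_pos, hurwitzZetaPos_one, deriv_riemannZeta_neg_two]
    rw [hG, Real.Gamma_one, Real.log_one] at h
    simp only [div_one] at h
    rw [h, hz1]
    push_cast
    rw [hz]
    ring
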